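/- For $g\ge 0$, a polarized real torus of dimension $g$ is $T=\mathbb R^{g}/\Lambda$, where $\Lambda\subset\mathbb R^{g}$ is a lattice, together with a polarization $E$ of the associated complex torus $\mathfrak A=\mathbb C^{g}/(\mathbb Z^{g}+i\Lambda)$ (an alternating form, integral on $\mathbb Z^g+i\Lambda$, such that $E(iu,v)+iE(u,v)$ is a positive definite Hermitian form on $\mathbb C^g$). So $\mathfrak A$ is an abelian variety. A period matrix of $T$ is a matrix $\Pi\in GL(g,\mathbb R)$ with $\Lambda=\Pi\,\mathbb Z^{g}$. Let $T_1,T_2$ be polarized real tori of dimensions $g_1,g_2$ with period matrices $\Pi_1,\Pi_2$ and associated abelian varieties $\mathfrak A_1,\mathfrak A_2$. Let ${\rm Ext}(T_2,T_1)_{\rm pt}$ be the set of isomorphism classes of extensions $0\to\mathfrak A_1\to\mathfrak A\to\mathfrak A_2\to 0$ (exact sequences of complex tori and holomorphic homomorphisms; an isomorphism of extensions is an isomorphism of the middle terms that induces the identity on $\mathfrak A_1$ and on $\mathfrak A_2$). For $e,e'\in{\rm Ext}(T_2,T_1)_{\rm pt}$ the Baer sum is $e+e'=\mu_*\Delta^*(e\times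 e')$, where $\Delta:\mathfrak A_2\to\mathfrak A_2\times\mathfrak A_2$ is the diagonal and $\mu:\mathfrak A_1\times\mathfrak A_1\to\mathfrak A_1$ is the addition. **Proposition 6.3.** The Baer sum is a well-defined operation that makes ${\rm Ext}(T_2,T_1)_{\rm pt}$ an abelian group, and there is an isomorphism of abelian groups $$\mathbb C^{(g_1,g_2)}\Big/ (I_{g_1},\,i\Pi_1)\,\mathbb Z^{(2g_1,2g_2)}\begin{pmatrix} i\Pi_2\\ I_{g_2}\end{pmatrix}\ \cong\ {\rm Ext}(T_2,T_1)_{\rm pt},$$ which sends the class of $\alpha\in\mathbb C^{(g_1,g_2)}$ to the class of the extension of $\mathfrak A_2$ by $\mathfrak A_1$ with middle term $\mathbb C^{g_1+g_2}\big/\widetilde\Pi_\alpha\mathbb Z^{2g_1+2g_2}$, where $$\widetilde\Pi_\alpha=\begin{pmatrix} I_{g_1}& i\Pi_1& 0&\alpha\\ 0&0&I_{g_2}& i\Pi_2\end{pmatrix},$$ and with the maps induced by $z\mapsto (z,0)$ and $(z,w)\mapsto w$. Here $\mathbb C^{(m,n)}$ and $\mathbb Z^{(m,n)}$ denote the groups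 of $m\times n$ matrices over $\mathbb C$ and $\mathbb Z$. -/

import Mathlib

open scoped Topology

/-! ### Complex tori and their homomorphisms -/

/-- A complex torus `V / Λ`: a finite dimensional complex vector space `V` together with a lattice
`Λ ⊆ V`, that is, a discrete subgroup spanning `V` over `ℝ`. -/
structure ComplexTorus where
  V : Type
  [normedAddCommGroup : NormedAddCommGroup V]
  [normedSpace : NormedSpace ℂ V]
  [finiteDimensional : FiniteDimensional ℂ V]
  lattice : Submodule ℤ V
  discrete : DiscreteTopology lattice
  spans : Submodule.span ℝ (lattice : Set V) = ⊤

namespace ComplexTorus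

attribute [instance] ComplexTorus.normedAddCommGroup ComplexTorus.normedSpace
  ComplexTorus.finiteDimensional

/-- The group `V / Λ` of points of a complex torus. -/
abbrev Points (A : ComplexTorus) : Type := A.V ⧸ A.lattice

/-- The projection `V → V / Λ`. -/
abbrev proj (A : ComplexTorus) : A.V →ₗ[ℤ] A.Points := A.lattice.mkQ

/-- A homomorphism of complex tori: a homomorphism of groups which is a holomorphic map.
Since `V → V / Λ` is a local biholomorphism (a covering), holomorphy means that locally the map
lifts to a holomorphic map between the covering vector spaces. -/
structure Hom (A B : ComplexTorus) where
  toFun : A.Points →+ B.Points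
  holomorphic : ∀ x : A.V, ∃ F : A.V → B.V, AnalyticAt ℂ F x ∧
    ∀ᶠ y in 𝓝 x, B.proj (F y) = toFun (A.proj y)

namespace Hom

instance (A B : ComplexTorus) : CoeFun (Hom A B) (fun _ => A.Points → B.Points) :=
  ⟨fun f => f.toFun⟩

/-- A complex linear map of the covering spaces that maps lattice to lattice induces a homomorphism
of complex tori. -/
def ofLinear {A B : ComplexTorus} (F : A.V →L[ℂ] B.V)
    (hF : ∀ x ∈ A.lattice, F x ∈ B.lattice) : Hom A B where
  toFun := (Submodule.mapQ A.lattice B.lattice (F.toLinearMap.restrictScalars ℤ)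
    hF).toAddMonoidHom
  holomorphic x := ⟨F, F.analyticAt x, Filter.Eventually.of_forall fun _ => rfl⟩

@[simp] theorem ofLinear_proj {A B : ComplexTorus} (F : A.V →L[ℂ] B.V)
    (hF : ∀ x ∈ A.lattice, F x ∈ B.lattice) (x : A.V) :
    ofLinear F hF (A.proj x) = B.proj (F x) := rfl

/-- The identity. -/
def id (A : ComplexTorus) : Hom A A where
  toFun := AddMonoidHom.id _
  holomorphic _ := ⟨fun y => y, analyticAt_id, Filter.Eventually.of_forall fun _ => rfl⟩

/-- Composition of homomorphisms. -/
def comp {A B C : ComplexTorus} (g : Hom B C) (f : Hom A B) : Hom A C where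
  toFun := g.toFun.comp f.toFun
  holomorphic x := by
    obtain ⟨F, hF, hF'⟩ := f.holomorphic x
    obtain ⟨G, hG, hG'⟩ := g.holomorphic (F x)
    refine ⟨G ∘ F, hG.comp hF, ?_⟩
    filter_upwards [hF', hF.continuousAt.eventually hG'] with y h1 h2
    simp only [Function.comp_apply, AddMonoidHom.comp_apply]
    rw [h2, h1]

/-- Pointwise sum of homomorphisms. -/
def add {A B : ComplexTorus} (f g : Hom A B) : Hom A B where
  toFun := f.toFun + g.toFun
  holomorphic x := by
    obtain ⟨F, hF, hF'⟩ := f.holomorphic x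
    obtain ⟨G, hG, hG'⟩ := g.holomorphic x
    refine ⟨F + G, hF.add hG, ?_⟩
    filter_upwards [hF', hG'] with y h1 h2
    rw [Pi.add_apply, map_add, h1, h2, AddMonoidHom.add_apply]

@[simp] theorem id_apply {A : ComplexTorus} (x : A.Points) : id A x = x := rfl

@[simp] theorem comp_apply {A B C : ComplexTorus} (g : Hom B C) (f : Hom A B) (x : A.Points) :
    comp g f x = g (f x) := rfl

@[simp] theorem add_apply {A B : ComplexTorus} (f g : Hom A B) (x : A.Points) :
    add f g x = f x + g x := rfl

end Hom

/-- A subgroup meeting some neighbourhood of `0` only in `0` is discrete. -/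
theorem discrete_of_nhds {V : Type} [NormedAddCommGroup V] (L : Submodule ℤ V)
    (h : ∃ U ∈ 𝓝 (0 : V), ∀ x ∈ L, x ∈ U → x = 0) : DiscreteTopology L := by
  obtain ⟨U, hU, h⟩ := h
  refine discreteTopology_of_isOpen_singleton_zero ?_
  have : ({0} : Set L) ∈ 𝓝 (0 : L) := by
    refine Filter.mem_of_superset (continuous_subtype_val.continuousAt.preimage_mem_nhds
      (x := (0 : L)) hU) ?_
    rintro ⟨x, hx⟩ hxU
    exact Subtype.ext (h x hx hxU)
  rw [isOpen_iff_mem_nhds]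
  rintro x rfl
  exact this

/-- A discrete subgroup meets some neighbourhood of `0` only in `0`. -/
theorem nhds_of_discrete {V : Type} [NormedAddCommGroup V] (L : Submodule ℤ V)
    (h : DiscreteTopology L) : ∃ U ∈ 𝓝 (0 : V), ∀ x ∈ L, x ∈ U → x = 0 := by
  have h0 : ({0} : Set L) ∈ 𝓝 (0 : L) := by simp
  rw [nhds_subtype_eq_comap, Filter.mem_comap] at h0
  obtain ⟨U, hU, h⟩ := h0
  exact ⟨U, hU, fun x hx hxU => congrArg Subtype.val (h (show (⟨x, hx⟩ : L) ∈ _ from hxU))⟩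

/-- The product of two complex tori. -/
noncomputable def prod (A B : ComplexTorus) : ComplexTorus where
  V := A.V × B.V
  lattice := A.lattice.prod B.lattice
  discrete := by
    obtain ⟨U, hU, h⟩ := nhds_of_discrete _ A.discrete
    obtain ⟨U', hU', h'⟩ := nhds_of_discrete _ B.discrete
    exact discrete_of_nhds _ ⟨U ×ˢ U', prod_mem_nhds hU hU',
      fun x hx hxU => Prod.ext (h _ hx.1 hxU.1) (h' _ hx.2 hxU.2)⟩
  spans := by
    rw [eq_top_iff]
    have hA : ∀ x : A.V, ((x, 0) : A.V × B.V) ∈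
        Submodule.span ℝ ((A.lattice.prod B.lattice : Submodule ℤ (A.V × B.V)) : Set _) := by
      intro x
      have hx : x ∈ Submodule.span ℝ (A.lattice : Set A.V) := by rw [A.spans]; trivial
      induction hx using Submodule.span_induction with
      | mem x hx => exact Submodule.subset_span ⟨hx, B.lattice.zero_mem⟩
      | zero => exact Submodule.zero_mem _
      | add x y _ _ hx hy => simpa using Submodule.add_mem _ hx hy
      | smul a x _ hx => simpa using Submodule.smul_mem _ a hx
    have hB : ∀ x : B.V, ((0, x) : A.V × B.V) ∈
        Submodule.span ℝ ((A.lattice.prod B.lattice : Submodule ℤ (A.V × B.V)) : Set _) := by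
      intro x
      have hx : x ∈ Submodule.span ℝ (B.lattice : Set B.V) := by rw [B.spans]; trivial
      induction hx using Submodule.span_induction with
      | mem x hx => exact Submodule.subset_span ⟨A.lattice.zero_mem, hx⟩
      | zero => exact Submodule.zero_mem _
      | add x y _ _ hx hy => simpa using Submodule.add_mem _ hx hy
      | smul a x _ hx => simpa using Submodule.smul_mem _ a hx
    rintro ⟨x, y⟩ -
    simpa using Submodule.add_mem _ (hA x) (hB y)

namespace Hom

/-- First projection. -/
noncomputable def fst (A B : ComplexTorus) : Hom (A.prod B) A :=
  ofLinear (A := A.prod B) (B := A) (ContinuousLinearMap.fst ℂ A.V B.V) (fun _ hx => hx.1)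

/-- Second projection. -/
noncomputable def snd (A B : ComplexTorus) : Hom (A.prod B) B :=
  ofLinear (A := A.prod B) (B := B) (ContinuousLinearMap.snd ℂ A.V B.V) (fun _ hx => hx.2)

/-- First inclusion `a ↦ (a, 0)`. -/
noncomputable def inl (A B : ComplexTorus) : Hom A (A.prod B) :=
  ofLinear (A := A) (B := A.prod B) (ContinuousLinearMap.inl ℂ A.V B.V)
    (fun _ hx => ⟨hx, B.lattice.zero_mem⟩)

/-- Second inclusion `b ↦ (0, b)`. -/
noncomputable def inr (A B : ComplexTorus) : Hom B (A.prod B) :=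
  ofLinear (A := B) (B := A.prod B) (ContinuousLinearMap.inr ℂ A.V B.V)
    (fun _ hx => ⟨A.lattice.zero_mem, hx⟩)

/-- The homomorphism `x ↦ (f x, g x)` into a product. -/
noncomputable def pair {A B C : ComplexTorus} (f : Hom C A) (g : Hom C B) : Hom C (A.prod B) :=
  add (comp (inl A B) f) (comp (inr A B) g)

/-- The product homomorphism `(x, y) ↦ (f x, g y)`. -/
noncomputable def prodMap {A B C D : ComplexTorus} (f : Hom A C) (g : Hom B D) :
    Hom (A.prod B) (C.prod D) :=
  pair (comp f (fst A B)) (comp g (snd A B))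

/-- The diagonal `Δ : A → A × A`, `x ↦ (x, x)`. -/
noncomputable def diag (A : ComplexTorus) : Hom A (A.prod A) := pair (id A) (id A)

/-- The addition `μ : A × A → A`, `(x, y) ↦ x + y`. -/
noncomputable def sum (A : ComplexTorus) : Hom (A.prod A) A := add (fst A A) (snd A A)

@[simp] theorem fst_inl {A B : ComplexTorus} (x : A.Points) : fst A B (inl A B x) = x := by
  obtain ⟨x, rfl⟩ := Submodule.mkQ_surjective _ x
  rfl

@[simp] theorem snd_inl {A B : ComplexTorus} (x : A.Points) : snd A B (inl A B x) = 0 := by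
  obtain ⟨x, rfl⟩ := Submodule.mkQ_surjective _ x
  exact (snd A B).toFun.map_zero

@[simp] theorem fst_inr {A B : ComplexTorus} (x : B.Points) : fst A B (inr A B x) = 0 := by
  obtain ⟨x, rfl⟩ := Submodule.mkQ_surjective _ x
  exact (fst A B).toFun.map_zero

@[simp] theorem snd_inr {A B : ComplexTorus} (x : B.Points) : snd A B (inr A B x) = x := by
  obtain ⟨x, rfl⟩ := Submodule.mkQ_surjective _ x
  rfl

@[simp] theorem fst_pair {A B C : ComplexTorus} (f : Hom C A) (g : Hom C B) (x : C.Points) :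
    fst A B (pair f g x) = f x := by
  simp [pair]

@[simp] theorem snd_pair {A B C : ComplexTorus} (f : Hom C A) (g : Hom C B) (x : C.Points) :
    snd A B (pair f g x) = g x := by
  simp [pair]

theorem prod_ext {A B : ComplexTorus} {x y : (A.prod B).Points}
    (h1 : fst A B x = fst A B y) (h2 : snd A B x = snd A B y) : x = y := by
  obtain ⟨⟨x, x'⟩, rfl⟩ := Submodule.mkQ_surjective _ x
  obtain ⟨⟨y, y'⟩, rfl⟩ := Submodule.mkQ_surjective _ y
  have h1' := (Submodule.Quotient.eq A.lattice).1 h1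
  have h2' := (Submodule.Quotient.eq B.lattice).1 h2
  exact (Submodule.Quotient.eq (A.lattice.prod B.lattice)).2 ⟨h1', h2'⟩

end Hom

/-! ### Extensions of complex tori, Baer sum -/

/-- An extension `0 → A₁ → A → A₂ → 0` of the complex torus `A₂` by the complex torus `A₁`:
an exact sequence of complex tori and homomorphisms of complex tori. -/
structure Extension (A₂ A₁ : ComplexTorus) where
  mid : ComplexTorus
  ι : Hom A₁ mid
  p : Hom mid A₂
  injective : Function.Injective ι
  surjective : Function.Surjective p
  exact : Function.Exact ι p

namespace Extension

variable {A₁ A₂ : ComplexTorus}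

/-- Two extensions are isomorphic if there is an isomorphism of the middle terms (with inverse `g`)
inducing the identity on `A₁` and on `A₂`. -/
def IsIso (e e' : Extension A₂ A₁) : Prop :=
  ∃ (f : Hom e.mid e'.mid) (g : Hom e'.mid e.mid),
    (∀ x, g (f x) = x) ∧ (∀ y, f (g y) = y) ∧
    (∀ a, f (e.ι a) = e'.ι a) ∧ (∀ x, e'.p (f x) = e.p x)

instance setoid (A₂ A₁ : ComplexTorus) : Setoid (Extension A₂ A₁) where
  r := IsIso
  iseqv := by
    refine ⟨fun e => ⟨Hom.id _, Hom.id _, fun _ => rfl, fun _ => rfl, fun _ => rfl, fun _ => rfl⟩,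
      ?_, ?_⟩
    · rintro e e' ⟨f, g, h1, h2, h3, h4⟩
      exact ⟨g, f, h2, h1, fun a => by rw [← h3, h1], fun x => by rw [← h4, h2]⟩
    · rintro e e' e'' ⟨f, g, h1, h2, h3, h4⟩ ⟨f', g', h1', h2', h3', h4'⟩
      refine ⟨Hom.comp f' f, Hom.comp g g', ?_, ?_, ?_, ?_⟩ <;> intro x <;>
        simp only [Hom.comp_apply, h1, h2, h3, h4, h1', h2', h3', h4']

/-- The product `0 → A₁ × B₁ → A × B → A₂ × B₂ → 0` of two extensions. -/
noncomputable def prod {B₁ B₂ : ComplexTorus} (e : Extension A₂ A₁) (e' : Extension B₂ B₁) :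
    Extension (A₂.prod B₂) (A₁.prod B₁) where
  mid := e.mid.prod e'.mid
  ι := Hom.prodMap e.ι e'.ι
  p := Hom.prodMap e.p e'.p
  injective x y h := by
    have h1 := congrArg (Hom.fst _ _) h
    have h2 := congrArg (Hom.snd _ _) h
    simp only [Hom.prodMap, Hom.fst_pair, Hom.snd_pair, Hom.comp_apply] at h1 h2
    exact Hom.prod_ext (e.injective h1) (e'.injective h2)
  surjective y := by
    obtain ⟨a, ha⟩ := e.surjective (Hom.fst _ _ y)
    obtain ⟨b, hb⟩ := e'.surjective (Hom.snd _ _ y)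
    refine ⟨Hom.inl _ _ a + Hom.inr _ _ b, Hom.prod_ext ?_ ?_⟩
    · simp [Hom.prodMap, ha]
    · simp [Hom.prodMap, hb]
  exact y := by
    constructor
    · intro h
      have h1 := congrArg (Hom.fst _ _) h
      have h2 := congrArg (Hom.snd _ _) h
      simp only [Hom.prodMap, Hom.fst_pair, Hom.snd_pair, Hom.comp_apply, map_zero] at h1 h2
      obtain ⟨a, ha⟩ := (e.exact _).1 h1
      obtain ⟨b, hb⟩ := (e'.exact _).1 h2
      refine ⟨Hom.inl _ _ a + Hom.inr _ _ b, Hom.prod_ext ?_ ?_⟩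
      · simp [Hom.prodMap, ha]
      · simp [Hom.prodMap, hb]
    · rintro ⟨x, rfl⟩
      refine Hom.prod_ext ?_ ?_
      · simp [Hom.prodMap, e.exact.apply_apply_eq_zero]
      · simp [Hom.prodMap, e'.exact.apply_apply_eq_zero]

/-- `e'` is the pullback `φ^*(e)` of the extension `e` of `A₂` by `A₁` along `φ : B₂ → A₂`:
there is a homomorphism of the middle terms making the diagram with exact rows
`0 → A₁ → A' → B₂ → 0` and `0 → A₁ → A → A₂ → 0`, vertical maps `id` and `φ`, commute. -/
def IsPullback {B₂ : ComplexTorus} (φ : Hom B₂ A₂) (e : Extension A₂ A₁)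
    (e' : Extension B₂ A₁) : Prop :=
  ∃ f : Hom e'.mid e.mid, (∀ a, f (e'.ι a) = e.ι a) ∧ (∀ x, e.p (f x) = φ (e'.p x))

/-- `e'` is the pushout `ψ_*(e)` of the extension `e` of `A₂` by `A₁` along `ψ : A₁ → B₁`:
there is a homomorphism of the middle terms making the diagram with exact rows
`0 → A₁ → A → A₂ → 0` and `0 → B₁ → A' → A₂ → 0`, vertical maps `ψ` and `id`, commute. -/
def IsPushout {B₁ : ComplexTorus} (ψ : Hom A₁ B₁) (e : Extension A₂ A₁)
    (e' : Extension A₂ B₁) : Prop :=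
  ∃ f : Hom e.mid e'.mid, (∀ a, f (e.ι a) = e'.ι (ψ a)) ∧ (∀ x, e'.p (f x) = e.p x)

/-- `e''` is the Baer sum `μ_* Δ^* (e × e')` of `e` and `e'`. -/
def IsBaerSum (e e' e'' : Extension A₂ A₁) : Prop :=
  ∃ s : Extension A₂ (A₁.prod A₁),
    IsPullback (Hom.diag A₂) (e.prod e') s ∧ IsPushout (Hom.sum A₁) s e''

end Extension

/-- `Ext(A₂, A₁)`: the set of isomorphism classes of extensions of `A₂` by `A₁`. -/
def Ext (A₂ A₁ : ComplexTorus) : Type 1 := Quotient (Extension.setoid A₂ A₁)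

/-- The isomorphism class of an extension. -/
def Extension.cls {A₁ A₂ : ComplexTorus} (e : Extension A₂ A₁) : Ext A₂ A₁ :=
  Quotient.mk _ e

/-- The class `c` is the Baer sum of the classes `a` and `b`. -/
def Ext.IsBaerSum {A₁ A₂ : ComplexTorus} (a b c : Ext A₂ A₁) : Prop :=
  ∃ e e' e'' : Extension A₂ A₁, e.cls = a ∧ e'.cls = b ∧ e''.cls = c ∧
    Extension.IsBaerSum e e' e''

end ComplexTorus

/-! ### Polarized real tori -/

/-- For a subgroup `Λ ⊆ ℝ^g`, the subgroup `ℤ^g + iΛ` of `ℂ^g`. -/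
def complexifiedLattice {g : ℕ} (Λ : Submodule ℤ (Fin g → ℝ)) : Submodule ℤ (Fin g → ℂ) where
  carrier := {z | ∃ n : Fin g → ℤ, ∃ v ∈ Λ, z = fun j => (n j : ℂ) + Complex.I * (v j : ℂ)}
  zero_mem' := ⟨0, 0, Λ.zero_mem, by ext; simp⟩
  add_mem' := by
    rintro _ _ ⟨n, v, hv, rfl⟩ ⟨n', v', hv', rfl⟩
    refine ⟨n + n', v + v', Λ.add_mem hv hv', ?_⟩
    ext j
    simp
    ring
  smul_mem' := by
    rintro c _ ⟨n, v, hv, rfl⟩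
    refine ⟨c • n, c • v, Λ.smul_mem c hv, ?_⟩
    ext j
    simp
    ring

/-- A polarized real torus `T = ℝ^g / Λ`: a lattice `Λ ⊆ ℝ^g` together with a polarization `E` on
the associated complex torus `ℂ^g / L`, `L = ℤ^g + iΛ`. Here `E` is an alternating form on `L`,
extended `ℝ`-linearly to `ℂ^g`, which is integral on `L` and for which
`H(u,v) = E(iu,v) + i E(u,v)` is a positive definite Hermitian form. The real structure on `ℂ^g / L`
is complex conjugation, which maps `L` to itself. -/
structure PolarizedRealTorus (g : ℕ) where
  lattice : Submodule ℤ (Fin g → ℝ)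
  discrete : DiscreteTopology lattice
  spans : Submodule.span ℝ (lattice : Set (Fin g → ℝ)) = ⊤
  E : (Fin g → ℂ) →ₗ[ℝ] (Fin g → ℂ) →ₗ[ℝ] ℝ
  alternating : ∀ u, E u u = 0
  integral : ∀ u ∈ complexifiedLattice lattice, ∀ v ∈ complexifiedLattice lattice,
    ∃ n : ℤ, E u v = n
  hermitian : ∀ u v, E (Complex.I • u) (Complex.I • v) = E u v
  positive : ∀ u, u ≠ 0 → 0 < E (Complex.I • u) u

namespace PolarizedRealTorus

open ComplexTorus

/-- `ℤ^g + iΛ` spans `ℂ^g` over `ℝ`. -/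
theorem span_complexifiedLattice {g : ℕ} (T : PolarizedRealTorus g) :
    Submodule.span ℝ ((complexifiedLattice T.lattice : Submodule ℤ (Fin g → ℂ)) :
      Set (Fin g → ℂ)) = ⊤ := by
  rw [eq_top_iff]
  set S := Submodule.span ℝ ((complexifiedLattice T.lattice : Submodule ℤ _) :
    Set (Fin g → ℂ)) with hS
  have h1 : ∀ j, (Pi.single j 1 : Fin g → ℂ) ∈ S := fun j =>
    Submodule.subset_span ⟨Pi.single j 1, 0, T.lattice.zero_mem, by
      ext k
      by_cases hk : k = j
      · subst hk; simp
      · simp [hk]⟩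
  have h2 : ∀ v : Fin g → ℝ, (fun j => Complex.I * (v j : ℂ)) ∈ S := by
    intro v
    have hv : v ∈ Submodule.span ℝ (T.lattice : Set (Fin g → ℝ)) := by rw [T.spans]; trivial
    induction hv using Submodule.span_induction with
    | mem v hv => exact Submodule.subset_span ⟨0, v, hv, by ext; simp⟩
    | zero =>
      have h0 : (fun j => Complex.I * ((0 : Fin g → ℝ) j : ℂ)) = 0 := by ext; simp
      rw [h0]
      exact S.zero_mem
    | add v w _ _ hv hw =>
      have h0 : (fun j => Complex.I * ((v + w) j : ℂ)) =
          (fun j => Complex.I * (v j : ℂ)) + fun j => Complex.I * (w j : ℂ) := by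
        ext; simp; ring
      rw [h0]
      exact S.add_mem hv hw
    | smul a v _ hv =>
      have h0 : (fun j => Complex.I * ((a • v) j : ℂ)) =
          a • (fun j => Complex.I * (v j : ℂ)) := by
        ext; simp; ring
      rw [h0]
      exact S.smul_mem a hv
  intro z _
  have hz : z = (∑ j, (z j).re • (Pi.single j 1 : Fin g → ℂ)) +
      fun j => Complex.I * (((z j).im : ℝ) : ℂ) := by
    ext k
    simp [Finset.sum_apply, Pi.single_apply, mul_comm Complex.I, Complex.re_add_im]
  rw [hz]
  exact S.add_mem (S.sum_mem fun j _ => S.smul_mem _ (h1 j)) (h2 _)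

/-- The abelian variety `𝔄 = ℂ^g / (ℤ^g + iΛ)` associated with a polarized real torus. -/
noncomputable def toComplexTorus {g : ℕ} (T : PolarizedRealTorus g) : ComplexTorus where
  V := Fin g → ℂ
  lattice := complexifiedLattice T.lattice
  discrete := by
    obtain ⟨U, hU, h⟩ := nhds_of_discrete _ T.discrete
    refine discrete_of_nhds _ ⟨{z | (∀ j, |(z j).re| < 1) ∧ (fun j => (z j).im) ∈ U}, ?_, ?_⟩
    · have h1 : ∀ᶠ z : Fin g → ℂ in 𝓝 0, ∀ j, |(z j).re| < 1 := by
        rw [Filter.eventually_all]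
        intro j
        have hc : Continuous fun z : Fin g → ℂ => |(z j).re| := by fun_prop
        exact hc.continuousAt.eventually_lt continuousAt_const (by simp)
      have h2 : ∀ᶠ z : Fin g → ℂ in 𝓝 0, (fun j => (z j).im) ∈ U := by
        have hc : Continuous fun z : Fin g → ℂ => fun j => (z j).im := by fun_prop
        refine hc.continuousAt.eventually_mem ?_
        have h0 : (fun j => ((0 : Fin g → ℂ) j).im) = (0 : Fin g → ℝ) := by ext; simp
        rw [h0]
        exact hU
      exact h1.and h2
    · rintro _ ⟨n, v, hv, rfl⟩ ⟨h1, h2⟩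
      have hv0 : v = 0 := h v hv (by simpa using h2)
      have hn0 : n = 0 := by
        ext j
        have := h1 j
        simp only [Complex.add_re, Complex.intCast_re, Complex.mul_re, Complex.I_re,
          Complex.ofReal_re, zero_mul, Complex.I_im, Complex.ofReal_im, mul_zero, sub_zero,
          add_zero] at this
        have h3 : |n j| < 1 := by exact_mod_cast this
        simpa using Int.abs_lt_one_iff.1 h3
      subst hv0 hn0
      ext j
      simp
  spans := T.span_complexifiedLattice

/-- `P ∈ GL(g, ℝ)` is a period matrix for `T = ℝ^g / Λ` if `Λ = P ℤ^g`. -/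
def IsPeriodMatrix {g : ℕ} (T : PolarizedRealTorus g) (P : GL (Fin g) ℝ) : Prop :=
  (T.lattice : Set (Fin g → ℝ)) =
    Set.range fun n : Fin g → ℤ => P.1.mulVec fun j => (n j : ℝ)

/-- `Ext(T₂, T₁)_pt`: the set of isomorphism classes of extensions of `𝔄₂` by `𝔄₁`, where `𝔄ᵢ` is the
abelian variety associated with `Tᵢ`. -/
abbrev ExtPt {g₁ g₂ : ℕ} (T₂ : PolarizedRealTorus g₂) (T₁ : PolarizedRealTorus g₁) : Type 1 :=
  ComplexTorus.Ext T₂.toComplexTorus T₁.toComplexTorus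

end PolarizedRealTorus

/-! ### Period matrices -/

/-- The matrix `i P`. -/
noncomputable def imagMatrix {g : ℕ} (P : GL (Fin g) ℝ) : Matrix (Fin g) (Fin g) ℂ :=
  Complex.I • P.1.map Complex.ofReal

/-- The period matrix `(I_g, iP)` of the complex torus `ℂ^g / (ℤ^g + i P ℤ^g)`. -/
noncomputable def bigPeriodMatrix {g : ℕ} (P : GL (Fin g) ℝ) :
    Matrix (Fin g) (Fin g ⊕ Fin g) ℂ :=
  Matrix.fromCols 1 (imagMatrix P)

/-- The subgroup `M ℤ^n` of `ℂ^m` generated by the columns of a complex matrix `M`. -/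
def columnLattice {m n : Type} [Fintype n] (M : Matrix m n ℂ) : Submodule ℤ (m → ℂ) where
  carrier := Set.range fun x : n → ℤ => M.mulVec fun j => (x j : ℂ)
  zero_mem' := ⟨0, by ext; simp [Matrix.mulVec, dotProduct]⟩
  add_mem' := by
    rintro _ _ ⟨x, rfl⟩ ⟨y, rfl⟩
    refine ⟨x + y, ?_⟩
    ext
    simp [Matrix.mulVec, dotProduct, mul_add, Finset.sum_add_distrib]
  smul_mem' := by
    rintro c _ ⟨x, rfl⟩
    refine ⟨c • x, ?_⟩
    ext
    simp [Matrix.mulVec, dotProduct, Finset.mul_sum, mul_left_comm]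

/-- The matrix with block rows `((I, iP₁), σ)` and `(0, (I, iP₂))`. -/
noncomputable def extensionPeriodMatrix {g₁ g₂ : ℕ} (P₁ : GL (Fin g₁) ℝ) (P₂ : GL (Fin g₂) ℝ)
    (σ : Matrix (Fin g₁) (Fin g₂ ⊕ Fin g₂) ℂ) :
    Matrix (Fin g₁ ⊕ Fin g₂) ((Fin g₁ ⊕ Fin g₁) ⊕ (Fin g₂ ⊕ Fin g₂)) ℂ :=
  Matrix.fromBlocks (bigPeriodMatrix P₁) σ 0 (bigPeriodMatrix P₂)

/-- The subgroup `(I_{g₁}, iP₁) ℤ^{(2g₁, 2g₂)} (iP₂ ; I_{g₂})` of `ℂ^{(g₁, g₂)}`, where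
`(iP₂ ; I_{g₂})` has block rows `iP₂` and `I_{g₂}`. -/
noncomputable def periodSubgroup {g₁ g₂ : ℕ} (P₁ : GL (Fin g₁) ℝ) (P₂ : GL (Fin g₂) ℝ) :
    AddSubgroup (Matrix (Fin g₁) (Fin g₂) ℂ) where
  carrier := Set.range fun M : Matrix (Fin g₁ ⊕ Fin g₁) (Fin g₂ ⊕ Fin g₂) ℤ =>
    bigPeriodMatrix P₁ * M.map (fun n : ℤ => (n : ℂ)) *
      (Matrix.fromRows (imagMatrix P₂) 1 : Matrix (Fin g₂ ⊕ Fin g₂) (Fin g₂) ℂ)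
  zero_mem' := ⟨0, by
    have h : (0 : Matrix (Fin g₁ ⊕ Fin g₁) (Fin g₂ ⊕ Fin g₂) ℤ).map (fun n : ℤ => (n : ℂ)) = 0 := by
      ext; simp
    simp only [h, Matrix.mul_zero, Matrix.zero_mul]⟩
  add_mem' := by
    rintro _ _ ⟨M, rfl⟩ ⟨N, rfl⟩
    refine ⟨M + N, ?_⟩
    have h : (M + N).map (fun n : ℤ => (n : ℂ)) =
        M.map (fun n : ℤ => (n : ℂ)) + N.map (fun n : ℤ => (n : ℂ)) := by
      ext; simp
    simp only [h, Matrix.mul_add, Matrix.add_mul]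
  neg_mem' := by
    rintro _ ⟨M, rfl⟩
    refine ⟨-M, ?_⟩
    have h : (-M).map (fun n : ℤ => (n : ℂ)) = -M.map (fun n : ℤ => (n : ℂ)) := by
      ext; simp
    simp only [h, Matrix.mul_neg, Matrix.neg_mul]

namespace PolarizedRealTorus

open ComplexTorus

variable {g₁ g₂ : ℕ} {T₁ : PolarizedRealTorus g₁} {T₂ : PolarizedRealTorus g₂}
  {P₁ : GL (Fin g₁) ℝ} {P₂ : GL (Fin g₂) ℝ}

/-- If `P` is a period matrix for `T`, then `ℤ^g + iΛ = (I, iP) ℤ^{2g}`. -/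
theorem IsPeriodMatrix.lattice_eq {g : ℕ} {T : PolarizedRealTorus g} {P : GL (Fin g) ℝ}
    (h : T.IsPeriodMatrix P) :
    T.toComplexTorus.lattice = columnLattice (bigPeriodMatrix P) := by
  have key : ∀ n m : Fin g → ℤ,
      (fun j => (n j : ℂ) + Complex.I * ((P.1.mulVec (fun k => (m k : ℝ)) j : ℝ) : ℂ)) =
        (bigPeriodMatrix P).mulVec fun j => ((Sum.elim n m j : ℤ) : ℂ) := by
    intro n m
    ext j
    simp [bigPeriodMatrix, imagMatrix, Matrix.mulVec, dotProduct, Matrix.one_apply,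
      Finset.mul_sum, mul_assoc]
  apply le_antisymm
  · rintro _ ⟨n, v, hv, rfl⟩
    have hv' : v ∈ (T.lattice : Set (Fin g → ℝ)) := hv
    rw [h] at hv'
    obtain ⟨m, rfl⟩ := hv'
    exact ⟨Sum.elim n m, (key n m).symm⟩
  · rintro _ ⟨x, rfl⟩
    have hm : P.1.mulVec (fun k => ((x (Sum.inr k) : ℤ) : ℝ)) ∈ (T.lattice : Set (Fin g → ℝ)) := by
      rw [h]
      exact ⟨fun k => x (Sum.inr k), rfl⟩
    refine ⟨fun k => x (Sum.inl k), _, hm, ?_⟩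
    rw [key]
    congr 1
    ext j
    cases j <;> rfl

/-- Membership in the lattice generated by the columns of the block matrix. -/
theorem mem_extensionLattice (σ : Matrix (Fin g₁) (Fin g₂ ⊕ Fin g₂) ℂ) (z : Fin g₁ ⊕ Fin g₂ → ℂ) :
    z ∈ columnLattice (extensionPeriodMatrix P₁ P₂ σ) ↔
      ∃ (x : Fin g₁ ⊕ Fin g₁ → ℤ) (y : Fin g₂ ⊕ Fin g₂ → ℤ),
        z ∘ Sum.inl = (bigPeriodMatrix P₁).mulVec (fun j => (x j : ℂ)) +
          σ.mulVec (fun j => (y j : ℂ)) ∧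
        z ∘ Sum.inr = (bigPeriodMatrix P₂).mulVec fun j => (y j : ℂ) := by
  constructor
  · rintro ⟨w, rfl⟩
    refine ⟨w ∘ Sum.inl, w ∘ Sum.inr, ?_, ?_⟩ <;>
    · ext j
      simp [extensionPeriodMatrix, Matrix.fromBlocks_mulVec, Function.comp_def]
  · rintro ⟨x, y, h1, h2⟩
    refine ⟨Sum.elim x y, ?_⟩
    ext j
    cases j with
    | inl j =>
      have := congrFun h1 j
      simp only [Function.comp_apply] at this
      simp [this, extensionPeriodMatrix, Matrix.fromBlocks_mulVec, Function.comp_def]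
    | inr j =>
      have := congrFun h2 j
      simp only [Function.comp_apply] at this
      simp [this, extensionPeriodMatrix, Matrix.fromBlocks_mulVec, Function.comp_def]

/-- The columns of `(I, iP)` are linearly independent over `ℤ`. -/
theorem bigPeriodMatrix_injective {g : ℕ} {P : GL (Fin g) ℝ} {y : Fin g ⊕ Fin g → ℤ}
    (h : (bigPeriodMatrix P).mulVec (fun j => (y j : ℂ)) = 0) : y = 0 := by
  have key : ∀ j, (bigPeriodMatrix P).mulVec (fun j => (y j : ℂ)) j =
      ((y (Sum.inl j) : ℝ) : ℂ) +
        Complex.I * ((P.1.mulVec (fun k => ((y (Sum.inr k) : ℤ) : ℝ)) j : ℝ) : ℂ) := by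
    intro j
    simp [bigPeriodMatrix, imagMatrix, Matrix.mulVec, dotProduct, Matrix.one_apply,
      Finset.mul_sum, mul_assoc]
  have h1 : ∀ j, y (Sum.inl j) = 0 := by
    intro j
    have := congrArg Complex.re ((key j).symm.trans (congrFun h j))
    simpa using this
  have h2 : P.1.mulVec (fun k => ((y (Sum.inr k) : ℤ) : ℝ)) = 0 := by
    ext j
    have := congrArg Complex.im ((key j).symm.trans (congrFun h j))
    simpa using this
  have h3 : (fun k => ((y (Sum.inr k) : ℤ) : ℝ)) = 0 := by
    have h4 := congrArg (P⁻¹).1.mulVec h2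
    rw [Matrix.mulVec_mulVec, Matrix.mulVec_zero] at h4
    simpa using h4
  ext j
  cases j with
  | inl j => exact h1 j
  | inr j => simpa using congrFun h3 j

theorem inl_mem (h₁ : T₁.IsPeriodMatrix P₁) (σ : Matrix (Fin g₁) (Fin g₂ ⊕ Fin g₂) ℂ)
    {z : Fin g₁ → ℂ} (hz : z ∈ T₁.toComplexTorus.lattice) :
    (Sum.elim z 0 : Fin g₁ ⊕ Fin g₂ → ℂ) ∈ columnLattice (extensionPeriodMatrix P₁ P₂ σ) := by
  rw [h₁.lattice_eq] at hz
  obtain ⟨x, rfl⟩ := hz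
  refine (mem_extensionLattice σ _).2 ⟨x, 0, ?_, ?_⟩
  · ext j; simp [Matrix.mulVec, dotProduct]
  · ext j; simp [Matrix.mulVec, dotProduct]

theorem inr_mem (h₂ : T₂.IsPeriodMatrix P₂) (σ : Matrix (Fin g₁) (Fin g₂ ⊕ Fin g₂) ℂ)
    {z : Fin g₁ ⊕ Fin g₂ → ℂ} (hz : z ∈ columnLattice (extensionPeriodMatrix P₁ P₂ σ)) :
    z ∘ Sum.inr ∈ T₂.toComplexTorus.lattice := by
  obtain ⟨x, y, -, h⟩ := (mem_extensionLattice σ _).1 hz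
  rw [h₂.lattice_eq]
  exact ⟨y, h.symm⟩

theorem inl_of_inr_eq_zero (h₁ : T₁.IsPeriodMatrix P₁)
    (σ : Matrix (Fin g₁) (Fin g₂ ⊕ Fin g₂) ℂ) {z : Fin g₁ ⊕ Fin g₂ → ℂ}
    (hz : z ∈ columnLattice (extensionPeriodMatrix P₁ P₂ σ)) (h0 : z ∘ Sum.inr = 0) :
    z ∘ Sum.inl ∈ T₁.toComplexTorus.lattice := by
  obtain ⟨x, y, h, h'⟩ := (mem_extensionLattice σ _).1 hz
  obtain rfl : y = 0 := bigPeriodMatrix_injective (h'.symm.trans h0)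
  rw [h₁.lattice_eq]
  refine ⟨x, ?_⟩
  rw [h]
  ext j
  simp [Matrix.mulVec, dotProduct]

theorem exists_of_mem (h₂ : T₂.IsPeriodMatrix P₂) (σ : Matrix (Fin g₁) (Fin g₂ ⊕ Fin g₂) ℂ)
    {w : Fin g₂ → ℂ} (hw : w ∈ T₂.toComplexTorus.lattice) :
    ∃ v, (Sum.elim v w : Fin g₁ ⊕ Fin g₂ → ℂ) ∈ columnLattice (extensionPeriodMatrix P₁ P₂ σ) := by
  rw [h₂.lattice_eq] at hw
  obtain ⟨y, rfl⟩ := hw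
  refine ⟨σ.mulVec (fun j => (y j : ℂ)), (mem_extensionLattice σ _).2 ⟨0, y, ?_, ?_⟩⟩
  · ext j; simp [Matrix.mulVec, dotProduct]
  · ext j; simp

/-- The complex torus `ℂ^{g₁+g₂} / Π_σ ℤ^{2g₁+2g₂}`, where `Π_σ` is the matrix with block rows
`((I, iP₁), σ)` and `(0, (I, iP₂))`. -/
noncomputable def extensionTorus (h₁ : T₁.IsPeriodMatrix P₁) (h₂ : T₂.IsPeriodMatrix P₂)
    (σ : Matrix (Fin g₁) (Fin g₂ ⊕ Fin g₂) ℂ) : ComplexTorus where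
  V := Fin g₁ ⊕ Fin g₂ → ℂ
  lattice := columnLattice (extensionPeriodMatrix P₁ P₂ σ)
  discrete := by
    obtain ⟨U₁, hU₁, hd₁⟩ := nhds_of_discrete _ T₁.toComplexTorus.discrete
    obtain ⟨U₂, hU₂, hd₂⟩ := nhds_of_discrete _ T₂.toComplexTorus.discrete
    refine discrete_of_nhds _ ⟨{z | z ∘ Sum.inl ∈ U₁ ∧ z ∘ Sum.inr ∈ U₂}, ?_, ?_⟩
    · have c₁ : Continuous fun z : Fin g₁ ⊕ Fin g₂ → ℂ => z ∘ Sum.inl :=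
        continuous_pi fun j => continuous_apply _
      have c₂ : Continuous fun z : Fin g₁ ⊕ Fin g₂ → ℂ => z ∘ Sum.inr :=
        continuous_pi fun j => continuous_apply _
      exact Filter.inter_mem (c₁.continuousAt.preimage_mem_nhds hU₁)
        (c₂.continuousAt.preimage_mem_nhds hU₂)
    · rintro z hz ⟨hz₁, hz₂⟩
      have h0 : z ∘ Sum.inr = 0 := hd₂ _ (inr_mem h₂ σ hz) hz₂
      have h0' : z ∘ Sum.inl = 0 := hd₁ _ (inl_of_inr_eq_zero h₁ σ hz h0) hz₁
      ext j
      cases j with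
      | inl j => exact congrFun h0' j
      | inr j => exact congrFun h0 j
  spans := by
    rw [eq_top_iff]
    set S := Submodule.span ℝ ((columnLattice (extensionPeriodMatrix P₁ P₂ σ) :
      Submodule ℤ _) : Set (Fin g₁ ⊕ Fin g₂ → ℂ)) with hS
    have k1 : ∀ v : Fin g₁ → ℂ, (Sum.elim v 0 : Fin g₁ ⊕ Fin g₂ → ℂ) ∈ S := by
      intro v
      have hv : v ∈ Submodule.span ℝ
          ((complexifiedLattice T₁.lattice : Submodule ℤ (Fin g₁ → ℂ)) : Set (Fin g₁ → ℂ)) := by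
        rw [span_complexifiedLattice]
        trivial
      induction hv using Submodule.span_induction with
      | mem v hv => exact Submodule.subset_span (inl_mem h₁ σ hv)
      | zero => exact (by ext j; cases j <;> rfl : (Sum.elim 0 0 : Fin g₁ ⊕ Fin g₂ → ℂ) = 0) ▸
          S.zero_mem
      | add v w _ _ hv hw =>
        have e : (Sum.elim (v + w) 0 : Fin g₁ ⊕ Fin g₂ → ℂ) = Sum.elim v 0 + Sum.elim w 0 := by
          ext j; cases j <;> simp
        rw [e]
        exact S.add_mem hv hw
      | smul a v _ hv =>
        have e : (Sum.elim (a • v) 0 : Fin g₁ ⊕ Fin g₂ → ℂ) = a • Sum.elim v 0 := by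
          ext j; cases j <;> simp
        rw [e]
        exact S.smul_mem a hv
    have k2 : ∀ w : Fin g₂ → ℂ, ∃ v, (Sum.elim v w : Fin g₁ ⊕ Fin g₂ → ℂ) ∈ S := by
      intro w
      have hw : w ∈ Submodule.span ℝ
          ((complexifiedLattice T₂.lattice : Submodule ℤ (Fin g₂ → ℂ)) : Set (Fin g₂ → ℂ)) := by
        rw [span_complexifiedLattice]
        trivial
      induction hw using Submodule.span_induction with
      | mem w hw =>
        obtain ⟨v, hv⟩ := exists_of_mem (P₁ := P₁) h₂ σ hw
        exact ⟨v, Submodule.subset_span hv⟩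
      | zero => exact ⟨0, k1 0⟩
      | add w w' _ _ hw hw' =>
        obtain ⟨v, hv⟩ := hw
        obtain ⟨v', hv'⟩ := hw'
        refine ⟨v + v', ?_⟩
        have e : (Sum.elim (v + v') (w + w') : Fin g₁ ⊕ Fin g₂ → ℂ) =
            Sum.elim v w + Sum.elim v' w' := by
          ext j; cases j <;> simp
        rw [e]
        exact S.add_mem hv hv'
      | smul a w _ hw =>
        obtain ⟨v, hv⟩ := hw
        refine ⟨a • v, ?_⟩
        have e : (Sum.elim (a • v) (a • w) : Fin g₁ ⊕ Fin g₂ → ℂ) = a • Sum.elim v w := by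
          ext j; cases j <;> simp
        rw [e]
        exact S.smul_mem a hv
    intro z _
    obtain ⟨v, hv⟩ := k2 (z ∘ Sum.inr)
    have e : z = Sum.elim v (z ∘ Sum.inr) + Sum.elim (z ∘ Sum.inl - v) 0 := by
      ext j; cases j <;> simp
    rw [e]
    exact S.add_mem hv (k1 _)

/-- The inclusion `ℂ^{g₁} → ℂ^{g₁+g₂}`, `z ↦ (z, 0)`. -/
noncomputable def inclMap (g₁ g₂ : ℕ) : (Fin g₁ → ℂ) →L[ℂ] (Fin g₁ ⊕ Fin g₂ → ℂ) :=
  LinearMap.toContinuousLinearMap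
    { toFun := fun z => Sum.elim z 0
      map_add' := fun z w => by ext j; cases j <;> simp
      map_smul' := fun c z => by ext j; cases j <;> simp }

/-- The projection `ℂ^{g₁+g₂} → ℂ^{g₂}`, `(z, w) ↦ w`. -/
noncomputable def projMap (g₁ g₂ : ℕ) : (Fin g₁ ⊕ Fin g₂ → ℂ) →L[ℂ] (Fin g₂ → ℂ) :=
  LinearMap.toContinuousLinearMap
    { toFun := fun z => z ∘ Sum.inr
      map_add' := fun _ _ => rfl
      map_smul' := fun _ _ => rfl }

/-- The extension `0 → 𝔄₁ → ℂ^{g₁+g₂} / Π_σ ℤ^{2g₁+2g₂} → 𝔄₂ → 0` defined by the period matrix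
`Π_σ`; the maps are induced by `z ↦ (z, 0)` and `(z, w) ↦ w`. -/
noncomputable def periodExtension (h₁ : T₁.IsPeriodMatrix P₁) (h₂ : T₂.IsPeriodMatrix P₂)
    (σ : Matrix (Fin g₁) (Fin g₂ ⊕ Fin g₂) ℂ) :
    Extension T₂.toComplexTorus T₁.toComplexTorus where
  mid := extensionTorus h₁ h₂ σ
  ι := Hom.ofLinear (A := T₁.toComplexTorus) (B := extensionTorus h₁ h₂ σ) (inclMap g₁ g₂)
    (fun _ hz => inl_mem h₁ σ hz)
  p := Hom.ofLinear (A := extensionTorus h₁ h₂ σ) (B := T₂.toComplexTorus) (projMap g₁ g₂)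
    (fun _ hz => inr_mem h₂ σ hz)
  injective x y hxy := by
    obtain ⟨z, rfl⟩ := Submodule.mkQ_surjective _ x
    obtain ⟨w, rfl⟩ := Submodule.mkQ_surjective _ y
    have h := (Submodule.Quotient.eq (columnLattice (extensionPeriodMatrix P₁ P₂ σ))).1 hxy
    refine (Submodule.Quotient.eq _).2 ?_
    exact inl_of_inr_eq_zero h₁ σ h (by ext j; exact sub_self (0 : ℂ))
  surjective x := by
    obtain ⟨w, rfl⟩ := Submodule.mkQ_surjective _ x
    exact ⟨(extensionTorus h₁ h₂ σ).proj (Sum.elim 0 w : Fin g₁ ⊕ Fin g₂ → ℂ), rfl⟩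
  exact x := by
    constructor
    · obtain ⟨(z : Fin g₁ ⊕ Fin g₂ → ℂ), rfl⟩ := Submodule.mkQ_surjective _ x
      intro hx
      have hx' : (z : Fin g₁ ⊕ Fin g₂ → ℂ) ∘ Sum.inr ∈ T₂.toComplexTorus.lattice :=
        (Submodule.Quotient.mk_eq_zero _).1 hx
      obtain ⟨v, hv⟩ := exists_of_mem (P₁ := P₁) h₂ σ hx'
      refine ⟨T₁.toComplexTorus.proj (z ∘ Sum.inl - v : Fin g₁ → ℂ), ?_⟩
      refine (Submodule.Quotient.eq (columnLattice (extensionPeriodMatrix P₁ P₂ σ))).2 ?_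
      have e : (Sum.elim (z ∘ Sum.inl - v) 0 : Fin g₁ ⊕ Fin g₂ → ℂ) - z =
          -Sum.elim v (z ∘ Sum.inr) := by
        ext j; cases j <;> simp
      exact e.symm ▸ Submodule.neg_mem _ hv
    · rintro ⟨a, rfl⟩
      obtain ⟨z, rfl⟩ := Submodule.mkQ_surjective _ a
      exact (Hom.toFun (Hom.ofLinear (A := extensionTorus h₁ h₂ σ) (B := T₂.toComplexTorus)
        (projMap g₁ g₂) (fun _ hz => inr_mem h₂ σ hz))).map_zero

end PolarizedRealTorus

/-!
Extensions of complex tori are classified by additive maps of lattices, and everything reduces to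
linear algebra once homomorphisms of tori are replaced by linear maps of their covering spaces.

Write `Aᵢ = Vᵢ / Λᵢ`. A homomorphism of complex tori lifts uniquely to a complex linear map
(`Hom.exists_isLift`, `Hom.IsLift.unique`): a local lift is additive because lattices are discrete,
and a differentiable additive germ is its own derivative. An extension `0 → A₁ → A → A₂ → 0` hence
lifts to an exact sequence `0 → V₁ → V → V₂ → 0` of vector spaces; exactness uses that lattices are
countable while complex lines are not (`mem_of_forall_smul`). Choose a complex linear section `S`
of `V → V₂` and a section `k` of the surjection of lattices `Λ → Λ₂`, which exists as `Λ₂` is free.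
Their difference is an additive map `h : Λ₂ → V₁`, the cocycle of the extension, and every such
`h` occurs (`ofCocycle`).

A homomorphism between two extensions over given homomorphisms of the ends exists precisely if the
two cocycles agree up to a complex linear map `V₂ → V₁` and values in the lattice
(`exists_hom_iff`). Applied to the identities of the ends, this shows that extension classes
correspond to the cocycles modulo the subgroup of coboundaries (`cocycleEquiv`). Applied to the
diagonal and the addition, it shows that the Baer sum, through whichever pullback and pushout it
is formed, is the sum of cocycles (`isBaerSum_iff`).

For polarized real tori with period matrices, subtracting a complex linear map makes a cocycle
vanish on `ℤ^g₂ ⊆ Λ₂`; it then has the form `n + iP₂m ↦ αm` for a matrix `α`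
(`exists_matrixCocycle_sub_mem_coboundaries`), and it is the cocycle of the extension with period
matrix given by `α` (`periodExtension_hasCocycle`). Such a cocycle is a coboundary if and only if
`α m + A (n + iP₂m)` is a period of `A₁` for some complex matrix `A` and all `n`, `m`. Thus
`A = (I, iP₁) M₁` and `α + A iP₂ = (I, iP₁) M₂` with integral matrices `M₁`, `M₂`, that is,
`α = (I, iP₁) (-M₁, M₂) (iP₂ ; I)` (`matrixCocycle_mem_coboundaries_iff`).
-/

namespace ComplexTorus

/-! ### Homomorphisms of complex tori and linear maps of their covering spaces -/

instance countable_lattice (A : ComplexTorus) : Countable A.lattice := by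
  have := A.discrete
  have : ProperSpace A.V := FiniteDimensional.proper ℂ A.V
  exact TopologicalSpace.separableSpace_iff_countable.1 inferInstance

instance free_lattice (A : ComplexTorus) : Module.Free ℤ A.lattice := by
  have := A.discrete
  have : IsZLattice ℝ A.lattice := ⟨A.spans⟩
  have : FiniteDimensional ℝ A.V := FiniteDimensional.complexToReal A.V
  exact ZLattice.module_free ℝ A.lattice

theorem proj_eq_zero {A : ComplexTorus} {x : A.V} : A.proj x = 0 ↔ x ∈ A.lattice :=
  Submodule.Quotient.mk_eq_zero _

theorem proj_eq {A : ComplexTorus} {x y : A.V} : A.proj x = A.proj y ↔ x - y ∈ A.lattice :=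
  Submodule.Quotient.eq _

/-- If the complex line through `v` lies in the countable union of translates `W + Λ` of a
complex subspace `W`, then `v ∈ W`: otherwise distinct points of the line would lie in distinct
translates, and `ℂ` would be countable. -/
theorem mem_of_forall_smul (A : ComplexTorus) (W : Submodule ℂ A.V) (v : A.V)
    (h : ∀ t : ℂ, ∃ w ∈ W, t • v - w ∈ A.lattice) : v ∈ W := by
  by_contra hv
  choose w hw hl using h
  have hinj : Function.Injective fun t : ℂ => (⟨t • v - w t, hl t⟩ : A.lattice) := by
    intro t s hts
    have h1 : t • v - w t = s • v - w s := congrArg Subtype.val hts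
    have h2 : (t - s) • v ∈ W := by
      have h3 : (t - s) • v = w t - w s := by
        rw [sub_smul, sub_eq_sub_iff_sub_eq_sub, h1]
      exact h3 ▸ W.sub_mem (hw t) (hw s)
    by_contra hne
    exact hv ((W.smul_mem_iff (sub_ne_zero.2 hne)).1 h2)
  exact not_countable_complex (Set.countable_univ_iff.2 hinj.countable)

/-- A complex line contained in the lattice is zero. -/
theorem eq_zero_of_forall_smul_mem {A : ComplexTorus} {v : A.V}
    (h : ∀ t : ℂ, t • v ∈ A.lattice) : v = 0 :=
  (Submodule.mem_bot ℂ).1 (mem_of_forall_smul A ⊥ v fun t => ⟨0, rfl, by simpa using h t⟩)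

/-- The linear map `F` of covering spaces lifts the homomorphism `f` of complex tori. -/
def Hom.IsLift {A B : ComplexTorus} (f : Hom A B) (F : A.V →ₗ[ℂ] B.V) : Prop :=
  ∀ x, f (A.proj x) = B.proj (F x)

namespace Hom

variable {A B C : ComplexTorus}

/-- Every homomorphism of complex tori lifts to a complex linear map. A local holomorphic lift
`G` with `G 0 = 0` is additive near `0`, because the lattice of `B` is discrete. Hence
`G x = n G (x / n)` for small `x`, and `n → ∞` identifies `G` near `0` with its derivative at
`0`. -/
theorem exists_isLift (f : Hom A B) : ∃ F, f.IsLift F := by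
  obtain ⟨F₀, hF₀, hev⟩ := f.holomorphic 0
  obtain ⟨U, hU, hdis⟩ := nhds_of_discrete _ B.discrete
  have h0 : F₀ 0 ∈ B.lattice := by
    rw [← proj_eq_zero, hev.self_of_nhds, map_zero]
    exact map_zero f.toFun
  set G : A.V → B.V := fun y => F₀ y - F₀ 0 with hG
  have hG0 : G 0 = 0 := sub_self _
  obtain ⟨L, hL⟩ : ∃ L, HasFDerivAt G L 0 :=
    ⟨_, (hF₀.differentiableAt.sub_const (F₀ 0)).hasFDerivAt⟩
  have hGev : ∀ᶠ y in 𝓝 0, B.proj (G y) = f (A.proj y) := by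
    filter_upwards [hev] with y hy
    rw [hG, map_sub, proj_eq_zero.2 h0, sub_zero, hy]
  have hadd : ∀ᶠ p : A.V × A.V in 𝓝 (0, 0), G (p.1 + p.2) = G p.1 + G p.2 := by
    have c1 : Filter.Tendsto (fun p : A.V × A.V => p.1) (𝓝 (0, 0)) (𝓝 0) :=
      continuous_fst.tendsto' _ _ rfl
    have c2 : Filter.Tendsto (fun p : A.V × A.V => p.2) (𝓝 (0, 0)) (𝓝 0) :=
      continuous_snd.tendsto' _ _ rfl
    have c3 : Filter.Tendsto (fun p : A.V × A.V => p.1 + p.2) (𝓝 (0, 0)) (𝓝 0) :=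
      continuous_add.tendsto' _ _ (add_zero _)
    have cG : Filter.Tendsto G (𝓝 0) (𝓝 0) := by
      have := hL.continuousAt.tendsto
      rwa [hG0] at this
    have c4 : Filter.Tendsto (fun p : A.V × A.V => G (p.1 + p.2) - (G p.1 + G p.2))
        (𝓝 (0, 0)) (𝓝 0) := by
      simpa using (cG.comp c3).sub ((cG.comp c1).add (cG.comp c2))
    filter_upwards [c1.eventually hGev, c2.eventually hGev, c3.eventually hGev,
      c4.eventually_mem hU] with p h1 h2 h3 h4
    refine sub_eq_zero.1 (hdis _ ?_ h4)
    rw [← proj_eq_zero, map_sub, map_add, h1, h2, h3, map_add]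
    exact sub_eq_zero.2 (map_add f.toFun _ _)
  obtain ⟨ε, hε, hball⟩ := Metric.eventually_nhds_iff.1 hGev
  obtain ⟨δ, hδ, hballδ⟩ := Metric.eventually_nhds_iff.1 hadd
  simp only [dist_zero_right] at hball
  have hadd' : ∀ x y : A.V, ‖x‖ < δ → ‖y‖ < δ → G (x + y) = G x + G y := by
    intro x y hx hy
    refine hballδ (y := (x, y)) ?_
    rw [Prod.dist_eq, dist_zero_right, dist_zero_right]
    exact max_lt hx hy
  have hdiv : ∀ (x : A.V) (n : ℕ), n ≠ 0 → n • ((n : ℂ)⁻¹ • x) = x := by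
    intro x n hn
    rw [← Nat.cast_smul_eq_nsmul ℂ, smul_inv_smul₀ (Nat.cast_ne_zero.2 hn)]
  have hsmul : ∀ (x : A.V) (n : ℕ), n ≠ 0 → ‖x‖ < δ → G x = n • G ((n : ℂ)⁻¹ • x) := by
    intro x n hn hx
    have key : ∀ k ≤ n, G (k • ((n : ℂ)⁻¹ • x)) = k • G ((n : ℂ)⁻¹ • x) := by
      have hb : ∀ k ≤ n, ‖k • ((n : ℂ)⁻¹ • x)‖ < δ := by
        intro k hk
        refine lt_of_le_of_lt ?_ hx
        rw [← Nat.cast_smul_eq_nsmul ℂ, smul_smul, norm_smul]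
        refine mul_le_of_le_one_left (norm_nonneg _) ?_
        rw [norm_mul, norm_inv, Complex.norm_natCast, Complex.norm_natCast]
        exact div_le_one_of_le₀ (Nat.cast_le.2 hk) (Nat.cast_nonneg _)
      intro k
      induction k with
      | zero => intro _; simp [hG0]
      | succ k ih =>
        intro hk
        have h1 := hb 1 (Nat.one_le_iff_ne_zero.2 hn)
        rw [one_smul] at h1
        rw [succ_nsmul, succ_nsmul, hadd' _ _ (hb k (by omega)) h1, ih (by omega)]
    have := key n le_rfl
    rwa [hdiv x n hn] at this
  have hGL : ∀ x : A.V, ‖x‖ < δ → G x = L x := by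
    intro x hx
    have hlim := hL.lim x (c := fun n : ℕ => (n : ℂ)) (l := Filter.atTop)
      (by simpa using tendsto_natCast_atTop_atTop)
    refine tendsto_nhds_unique ?_ hlim
    refine tendsto_const_nhds.congr' ?_
    filter_upwards [Filter.eventually_ne_atTop 0] with n hn
    rw [hsmul x n hn hx, zero_add, hG0, sub_zero, Nat.cast_smul_eq_nsmul]
  refine ⟨L.toLinearMap, fun x => ?_⟩
  obtain ⟨n, hn⟩ := exists_nat_gt (‖x‖ / min ε δ)
  have hm : 0 < min ε δ := lt_min hε hδ
  have hn0 : (0 : ℝ) < n := lt_of_le_of_lt (by positivity) hn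
  have hn' : n ≠ 0 := by rintro rfl; simp at hn0
  have hsmall : ‖(n : ℂ)⁻¹ • x‖ < min ε δ := by
    rw [norm_smul, norm_inv, Complex.norm_natCast, inv_mul_lt_iff₀ hn0]
    exact (div_lt_iff₀ hm).1 hn
  have h1 := hball (hsmall.trans_le (min_le_left _ _))
  rw [hGL _ (hsmall.trans_le (min_le_right _ _))] at h1
  calc f (A.proj x) = f (A.proj (n • ((n : ℂ)⁻¹ • x))) := by rw [hdiv x n hn']
    _ = n • f (A.proj ((n : ℂ)⁻¹ • x)) := by rw [map_nsmul]; exact map_nsmul f.toFun _ _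
    _ = B.proj (n • L ((n : ℂ)⁻¹ • x)) := by rw [← h1, map_nsmul]
    _ = B.proj (L x) := by rw [← map_nsmul L, hdiv x n hn']

theorem IsLift.mem {f : Hom A B} {F : A.V →ₗ[ℂ] B.V} (h : f.IsLift F) {x : A.V}
    (hx : x ∈ A.lattice) : F x ∈ B.lattice := by
  rw [← proj_eq_zero, ← h, proj_eq_zero.2 hx]
  exact map_zero f.toFun

theorem IsLift.comp {g : Hom B C} {f : Hom A B} {G : B.V →ₗ[ℂ] C.V} {F : A.V →ₗ[ℂ] B.V}
    (hg : g.IsLift G) (hf : f.IsLift F) : (Hom.comp g f).IsLift (G ∘ₗ F) := fun x => by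
  rw [comp_apply, hf, hg]; rfl

theorem isLift_id (A : ComplexTorus) : (Hom.id A).IsLift LinearMap.id := fun _ => rfl

/-- The lift of a homomorphism is unique, as a difference of two lifts maps complex lines into
the lattice. -/
theorem IsLift.unique {f g : Hom A B} {F G : A.V →ₗ[ℂ] B.V} (hf : f.IsLift F) (hg : g.IsLift G)
    (h : ∀ x, f x = g x) (x : A.V) : F x = G x := by
  refine sub_eq_zero.1 (eq_zero_of_forall_smul_mem fun t => ?_)
  rw [smul_sub, ← map_smul, ← map_smul, ← proj_eq, ← hf, ← hg, h]

/-- The homomorphism induced by a linear map which maps lattice to lattice. -/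
noncomputable def ofLinearMap (F : A.V →ₗ[ℂ] B.V) (hF : ∀ x ∈ A.lattice, F x ∈ B.lattice) :
    Hom A B :=
  ofLinear (LinearMap.toContinuousLinearMap F) hF

theorem isLift_ofLinearMap (F : A.V →ₗ[ℂ] B.V) (hF : ∀ x ∈ A.lattice, F x ∈ B.lattice) :
    (ofLinearMap F hF).IsLift F := fun _ => rfl

theorem IsLift.injective {f : Hom A B} {F : A.V →ₗ[ℂ] B.V} (h : f.IsLift F)
    (hf : Function.Injective f) : Function.Injective F := by
  refine (injective_iff_map_eq_zero F).2 fun v hv => eq_zero_of_forall_smul_mem fun t => ?_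
  rw [← proj_eq_zero]
  refine hf ?_
  rw [h, map_smul, hv, smul_zero, map_zero]
  exact (map_zero f.toFun).symm

theorem IsLift.surjective {f : Hom A B} {F : A.V →ₗ[ℂ] B.V} (h : f.IsLift F)
    (hf : Function.Surjective f) : Function.Surjective F := by
  refine fun v => mem_of_forall_smul B (LinearMap.range F) v fun t => ?_
  obtain ⟨a, ha⟩ := hf (B.proj (t • v))
  obtain ⟨x, rfl⟩ := Submodule.mkQ_surjective _ a
  exact ⟨F x, ⟨x, rfl⟩, proj_eq.1 (by rw [← ha, ← h])⟩

/-- The inverse of a bijective homomorphism of complex tori is holomorphic. -/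
theorem exists_inverse (f : Hom A B) (hf : Function.Bijective f) :
    ∃ g : Hom B A, (∀ x, g (f x) = x) ∧ ∀ y, f (g y) = y := by
  obtain ⟨F, hF⟩ := f.exists_isLift
  let e : A.V ≃ₗ[ℂ] B.V := LinearEquiv.ofBijective F ⟨hF.injective hf.1, hF.surjective hf.2⟩
  have he : ∀ x, F (e.symm x) = x := e.apply_symm_apply
  have hmem : ∀ x ∈ B.lattice, (e.symm : B.V →ₗ[ℂ] A.V) x ∈ A.lattice := by
    intro x hx
    rw [← proj_eq_zero]
    refine hf.1 ?_
    rw [hF, LinearEquiv.coe_coe, he, proj_eq_zero.2 hx]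
    exact (map_zero f.toFun).symm
  have h2 : ∀ y, f (ofLinearMap _ hmem y) = y := by
    intro y
    obtain ⟨x, rfl⟩ := Submodule.mkQ_surjective _ y
    rw [isLift_ofLinearMap _ hmem x, hF, LinearEquiv.coe_coe, he]
  exact ⟨ofLinearMap _ hmem, fun x => hf.1 (h2 _), h2⟩

end Hom

end ComplexTorus

namespace ComplexTorus

namespace Extension

/-! ### Cocycles of extensions -/

variable {A₁ A₂ B₁ B₂ : ComplexTorus}

/-- A linear presentation of an extension `0 → A₁ → A → A₂ → 0`: lifts `I` and `P` of the two
homomorphisms to the covering spaces, and a linear section `S` of `P`. -/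
structure Splitting (e : Extension A₂ A₁) where
  I : A₁.V →ₗ[ℂ] e.mid.V
  P : e.mid.V →ₗ[ℂ] A₂.V
  S : A₂.V →ₗ[ℂ] e.mid.V
  isLift_I : e.ι.IsLift I
  isLift_P : e.p.IsLift P
  P_S : ∀ w, P (S w) = w

/-- The additive map `h : Λ₂ → V₁` on the lattice of `A₂` is a cocycle of the extension `e` with
respect to the splitting `s` if `S w + I (h w)` is a period of the middle term for every
`w ∈ Λ₂`. -/
def Splitting.IsCocycle {e : Extension A₂ A₁} (s : e.Splitting) (h : A₂.lattice →ₗ[ℤ] A₁.V) :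
    Prop :=
  ∀ w : A₂.lattice, s.S w + s.I (h w) ∈ e.mid.lattice

/-- `h : Λ₂ → V₁` is a cocycle of the extension `e` with respect to some splitting. -/
def HasCocycle (e : Extension A₂ A₁) (h : A₂.lattice →ₗ[ℤ] A₁.V) : Prop :=
  ∃ s : e.Splitting, s.IsCocycle h

namespace Splitting

variable {e : Extension A₂ A₁}

theorem I_injective (s : e.Splitting) : Function.Injective s.I := s.isLift_I.injective e.injective

theorem P_I (s : e.Splitting) (v : A₁.V) : s.P (s.I v) = 0 := by
  refine eq_zero_of_forall_smul_mem fun t => ?_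
  rw [← map_smul, ← map_smul, ← proj_eq_zero, ← s.isLift_P, ← s.isLift_I]
  exact e.exact.apply_apply_eq_zero _

theorem I_mem_iff (s : e.Splitting) {v : A₁.V} : s.I v ∈ e.mid.lattice ↔ v ∈ A₁.lattice := by
  rw [← proj_eq_zero, ← proj_eq_zero, ← s.isLift_I]
  exact ⟨fun h => e.injective (h.trans (map_zero e.ι.toFun).symm),
    fun h => by rw [h]; exact map_zero e.ι.toFun⟩

/-- The covering spaces of an extension form an exact sequence. -/
theorem exists_I_eq {I : A₁.V →ₗ[ℂ] e.mid.V} {P : e.mid.V →ₗ[ℂ] A₂.V} (hI : e.ι.IsLift I)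
    (hP : e.p.IsLift P) {v : e.mid.V} (hv : P v = 0) : ∃ u, I u = v := by
  refine mem_of_forall_smul e.mid (LinearMap.range I) v fun t => ?_
  obtain ⟨a, ha⟩ := (e.exact (e.mid.proj (t • v))).1 (by rw [hP, map_smul, hv, smul_zero, map_zero])
  obtain ⟨x, rfl⟩ := Submodule.mkQ_surjective _ a
  exact ⟨I x, ⟨x, rfl⟩, proj_eq.1 (by rw [← ha, ← hI])⟩

/-- The linear retraction `V → V₁` complementary to the section `S`. -/
theorem exists_retraction (s : e.Splitting) :
    ∃ R : e.mid.V →ₗ[ℂ] A₁.V, (∀ v, s.I (R v) = v - s.S (s.P v)) ∧ ∀ u, R (s.I u) = u := by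
  obtain ⟨R, hR⟩ := LinearMap.exists_leftInverse_of_injective s.I
    (LinearMap.ker_eq_bot.2 s.I_injective)
  have hR' : ∀ u, R (s.I u) = u := fun u => LinearMap.congr_fun hR u
  refine ⟨R - R ∘ₗ s.S ∘ₗ s.P, fun v => ?_, fun u => ?_⟩
  · obtain ⟨u, hu⟩ := exists_I_eq s.isLift_I s.isLift_P (v := v - s.S (s.P v))
      (by rw [map_sub, s.P_S, sub_self])
    have : (R - R ∘ₗ s.S ∘ₗ s.P) v = R (v - s.S (s.P v)) := by simp
    rw [this, ← hu, hR']
  · simp [s.P_I, hR']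

end Splitting

theorem nonempty_splitting (e : Extension A₂ A₁) : Nonempty e.Splitting := by
  obtain ⟨I, hI⟩ := e.ι.exists_isLift
  obtain ⟨P, hP⟩ := e.p.exists_isLift
  obtain ⟨S, hS⟩ := LinearMap.exists_rightInverse_of_surjective P
    (LinearMap.range_eq_top.2 (hP.surjective e.surjective))
  exact ⟨⟨I, P, S, hI, hP, fun w => LinearMap.congr_fun hS w⟩⟩

/-- Every extension has a cocycle, because the lattice of `A₂` is free and so the surjection of
lattices `Λ → Λ₂` splits. -/
theorem exists_hasCocycle (e : Extension A₂ A₁) : ∃ h, e.HasCocycle h := by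
  obtain ⟨s⟩ := e.nonempty_splitting
  obtain ⟨R, hR, -⟩ := s.exists_retraction
  let π : e.mid.lattice →ₗ[ℤ] A₂.lattice :=
    (s.P.restrictScalars ℤ).restrict fun _ hx => s.isLift_P.mem hx
  have hπ : Function.Surjective π := by
    rintro ⟨w, hw⟩
    have h0 : e.p (e.mid.proj (s.S w)) = 0 := by rw [s.isLift_P, s.P_S, proj_eq_zero.2 hw]
    obtain ⟨a, ha⟩ := (e.exact _).1 h0
    obtain ⟨u, rfl⟩ := Submodule.mkQ_surjective _ a
    refine ⟨⟨s.S w - s.I u, proj_eq.1 (by rw [← ha, ← s.isLift_I])⟩, Subtype.ext ?_⟩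
    change s.P (s.S w - s.I u) = w
    rw [map_sub, s.P_S, s.P_I, sub_zero]
  obtain ⟨k, hk⟩ := Module.projective_lifting_property π LinearMap.id hπ
  have hk' : ∀ w, s.P (k w) = w := fun w => congrArg Subtype.val (LinearMap.congr_fun hk w)
  refine ⟨(R.restrictScalars ℤ) ∘ₗ e.mid.lattice.subtype ∘ₗ k, s, fun w => ?_⟩
  have : s.S w + s.I (R (k w)) = k w := by rw [hR, hk', add_sub_cancel]
  exact this ▸ (k w).2

/-- Morphisms of extensions in terms of cocycles: there is a homomorphism of middle terms over
`ψ : A₁ → B₁` and `φ : A₂ → B₂` if and only if the cocycles `ψ ∘ h` and `h' ∘ φ` differ, up to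
values in the lattice of `B₁`, by a complex linear map. -/
theorem exists_hom_iff {e : Extension A₂ A₁} {e' : Extension B₂ B₁}
    {h : A₂.lattice →ₗ[ℤ] A₁.V} {h' : B₂.lattice →ₗ[ℤ] B₁.V} (he : e.HasCocycle h)
    (he' : e'.HasCocycle h') {ψ : Hom A₁ B₁} {φ : Hom A₂ B₂} {Ψ : A₁.V →ₗ[ℂ] B₁.V}
    {Φ : A₂.V →ₗ[ℂ] B₂.V} (hψ : ψ.IsLift Ψ) (hφ : φ.IsLift Φ) :
    (∃ f : Hom e.mid e'.mid, (∀ a, f (e.ι a) = e'.ι (ψ a)) ∧ ∀ x, e'.p (f x) = φ (e.p x)) ↔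
      ∃ C : A₂.V →ₗ[ℂ] B₁.V, ∀ w : A₂.lattice,
        Ψ (h w) - h' ⟨Φ w, hφ.mem w.2⟩ + C w ∈ B₁.lattice := by
  obtain ⟨s, hs⟩ := he
  obtain ⟨s', hs'⟩ := he'
  obtain ⟨R, hR, hRI⟩ := s.exists_retraction
  obtain ⟨R', hR', -⟩ := s'.exists_retraction
  constructor
  · rintro ⟨f, hf₁, hf₂⟩
    obtain ⟨F, hF⟩ := f.exists_isLift
    have h₁ : ∀ u, F (s.I u) = s'.I (Ψ u) :=
      (hF.comp s.isLift_I).unique (s'.isLift_I.comp hψ) hf₁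
    have h₂ : ∀ v, s'.P (F v) = Φ (s.P v) :=
      (s'.isLift_P.comp hF).unique (hφ.comp s.isLift_P) hf₂
    -- The linear map `C` compares the section `F ∘ S` with the section `S'`.
    refine ⟨R' ∘ₗ F ∘ₗ s.S, fun w => ?_⟩
    rw [← s'.I_mem_iff]
    have h3 := hF.mem (hs w)
    have h4 := hs' ⟨Φ w, hφ.mem w.2⟩
    rw [map_add, h₁] at h3
    convert e'.mid.lattice.sub_mem h3 h4 using 1
    rw [map_add, map_sub, LinearMap.comp_apply, LinearMap.comp_apply, hR', h₂, s.P_S]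
    abel
  · rintro ⟨C, hC⟩
    let F : e.mid.V →ₗ[ℂ] e'.mid.V :=
      s'.S ∘ₗ Φ ∘ₗ s.P + s'.I ∘ₗ (C ∘ₗ s.P + Ψ ∘ₗ R)
    have hFapp : ∀ v, F v = s'.S (Φ (s.P v)) + s'.I (C (s.P v) + Ψ (R v)) := fun _ => rfl
    have hmem : ∀ v ∈ e.mid.lattice, F v ∈ e'.mid.lattice := by
      intro v hv
      let w : A₂.lattice := ⟨s.P v, s.isLift_P.mem hv⟩
      have h1 : R v - h w ∈ A₁.lattice := by
        rw [← s.I_mem_iff, map_sub, hR]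
        convert e.mid.lattice.sub_mem hv (hs w) using 1
        abel
      have h2 := s'.I_mem_iff.2 (B₁.lattice.add_mem (hψ.mem h1) (hC w))
      convert e'.mid.lattice.add_mem (hs' ⟨Φ w, hφ.mem w.2⟩) h2 using 1
      rw [hFapp, add_assoc, ← map_add, map_sub]
      congr 2
      change C w + _ = _
      abel
    refine ⟨Hom.ofLinearMap F hmem, fun a => ?_, fun x => ?_⟩
    · obtain ⟨u, rfl⟩ := Submodule.mkQ_surjective _ a
      rw [s.isLift_I, Hom.isLift_ofLinearMap, hψ, s'.isLift_I, hFapp, s.P_I, hRI]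
      simp
    · obtain ⟨v, rfl⟩ := Submodule.mkQ_surjective _ x
      rw [Hom.isLift_ofLinearMap, s'.isLift_P, s.isLift_P, hφ, hFapp, map_add, s'.P_S, s'.P_I,
        add_zero]

/-- A homomorphism of extensions inducing the identity on both ends is an isomorphism, by the
five lemma. -/
theorem isIso_of_hom {e e' : Extension A₂ A₁} (f : Hom e.mid e'.mid)
    (h₁ : ∀ a, f (e.ι a) = e'.ι a) (h₂ : ∀ x, e'.p (f x) = e.p x) : e.IsIso e' := by
  have hf : Function.Bijective f := by
    constructor
    · refine (injective_iff_map_eq_zero f.toFun).2 fun x hx => ?_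
      have h0 : e.p x = 0 := by rw [← h₂]; exact (congrArg e'.p hx).trans (map_zero e'.p.toFun)
      obtain ⟨a, rfl⟩ := (e.exact x).1 h0
      have ha : a = 0 := e'.injective ((h₁ a).symm.trans (hx.trans (map_zero e'.ι.toFun).symm))
      rw [ha]
      exact map_zero e.ι.toFun
    · intro y
      obtain ⟨x, hx⟩ := e.surjective (e'.p y)
      have h0 : e'.p (y - f x) = 0 :=
        (map_sub e'.p.toFun _ _).trans (sub_eq_zero.2 (by rw [← hx]; exact (h₂ x).symm))
      obtain ⟨a, ha⟩ := (e'.exact _).1 h0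
      refine ⟨x + e.ι a, (map_add f.toFun _ _).trans ?_⟩
      change f x + f (e.ι a) = y
      rw [h₁, ha, add_sub_cancel]
  obtain ⟨g, hg₁, hg₂⟩ := f.exists_inverse hf
  exact ⟨f, g, hg₁, hg₂, h₁, h₂⟩

/-- The subgroup of cocycles of the trivial extension: the additive maps `Λ₂ → V₁` which differ
from the restriction of a complex linear map by a map with values in `Λ₁`. -/
def coboundaries (A₂ A₁ : ComplexTorus) : AddSubgroup (A₂.lattice →ₗ[ℤ] A₁.V) where
  carrier := {h | ∃ C : A₂.V →ₗ[ℂ] A₁.V, ∀ w : A₂.lattice, h w + C w ∈ A₁.lattice}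
  zero_mem' := ⟨0, fun w => by simp⟩
  add_mem' := by
    rintro h h' ⟨C, hC⟩ ⟨C', hC'⟩
    refine ⟨C + C', fun w => ?_⟩
    convert A₁.lattice.add_mem (hC w) (hC' w) using 1
    simp only [LinearMap.add_apply]
    abel
  neg_mem' := by
    rintro h ⟨C, hC⟩
    refine ⟨-C, fun w => ?_⟩
    convert A₁.lattice.neg_mem (hC w) using 1
    simp only [LinearMap.neg_apply]
    abel

theorem cls_eq_iff {e e' : Extension A₂ A₁} {h h' : A₂.lattice →ₗ[ℤ] A₁.V} (he : e.HasCocycle h)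
    (he' : e'.HasCocycle h') : e.cls = e'.cls ↔ h - h' ∈ coboundaries A₂ A₁ := by
  have key := exists_hom_iff he he' (Hom.isLift_id A₁) (Hom.isLift_id A₂)
  refine Iff.trans ⟨fun H => ?_, fun H => ?_⟩ key
  · obtain ⟨f, -, -, -, h₁, h₂⟩ := Quotient.exact H
    exact ⟨f, h₁, h₂⟩
  · obtain ⟨f, h₁, h₂⟩ := H
    exact Quotient.sound (isIso_of_hom f h₁ h₂)

/-! ### Extensions with a given cocycle -/

/-- The lattice `{(v, w) | w ∈ Λ₂, v - h w ∈ Λ₁}` of `V₁ × V₂`. -/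
def cocycleLattice (h : A₂.lattice →ₗ[ℤ] A₁.V) : Submodule ℤ (A₁.V × A₂.V) where
  carrier := {x | ∃ w : A₂.lattice, (w : A₂.V) = x.2 ∧ x.1 - h w ∈ A₁.lattice}
  zero_mem' := ⟨0, rfl, by simp⟩
  add_mem' := by
    rintro x y ⟨w, hw, h₁⟩ ⟨w', hw', h₁'⟩
    refine ⟨w + w', by simp [hw, hw'], ?_⟩
    convert A₁.lattice.add_mem h₁ h₁' using 1
    rw [map_add, Prod.fst_add]
    abel
  smul_mem' := by
    rintro c x ⟨w, hw, h₁⟩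
    refine ⟨c • w, by simp [hw], ?_⟩
    convert A₁.lattice.smul_mem c h₁ using 1
    rw [map_smul, Prod.smul_fst, smul_sub]

theorem mk_mem_cocycleLattice {h : A₂.lattice →ₗ[ℤ] A₁.V} (w : A₂.lattice) :
    (h w, (w : A₂.V)) ∈ cocycleLattice h := ⟨w, rfl, by simp⟩

theorem inl_mem_cocycleLattice {h : A₂.lattice →ₗ[ℤ] A₁.V} {v : A₁.V} :
    (v, (0 : A₂.V)) ∈ cocycleLattice h ↔ v ∈ A₁.lattice := by
  constructor
  · rintro ⟨w, hw, h₁⟩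
    obtain rfl : w = 0 := Subtype.ext hw
    simpa using h₁
  · exact fun hv => ⟨0, rfl, by simpa using hv⟩

theorem snd_mem_of_mem_cocycleLattice {h : A₂.lattice →ₗ[ℤ] A₁.V} {x : A₁.V × A₂.V}
    (hx : x ∈ cocycleLattice h) : x.2 ∈ A₂.lattice := by
  obtain ⟨w, hw, -⟩ := hx
  exact hw ▸ w.2

/-- The middle term `(V₁ × V₂) / {(v, w) | w ∈ Λ₂, v - h w ∈ Λ₁}` of the extension with
cocycle `h`. -/
noncomputable def cocycleTorus (h : A₂.lattice →ₗ[ℤ] A₁.V) : ComplexTorus where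
  V := A₁.V × A₂.V
  lattice := cocycleLattice h
  discrete := by
    obtain ⟨U₁, hU₁, hd₁⟩ := nhds_of_discrete _ A₁.discrete
    obtain ⟨U₂, hU₂, hd₂⟩ := nhds_of_discrete _ A₂.discrete
    refine discrete_of_nhds _ ⟨U₁ ×ˢ U₂, prod_mem_nhds hU₁ hU₂, ?_⟩
    rintro ⟨v, w⟩ hx ⟨hv, hw⟩
    obtain rfl : w = 0 := hd₂ _ (snd_mem_of_mem_cocycleLattice hx) hw
    obtain rfl : v = 0 := hd₁ _ (inl_mem_cocycleLattice.1 hx) hv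
    rfl
  spans := by
    rw [eq_top_iff]
    set W := Submodule.span ℝ (cocycleLattice h : Set (A₁.V × A₂.V))
    have k₁ : ∀ v : A₁.V, (v, (0 : A₂.V)) ∈ W := by
      have : Submodule.span ℝ (A₁.lattice : Set A₁.V) ≤ W.comap (LinearMap.inl ℝ A₁.V A₂.V) :=
        Submodule.span_le.2 fun v hv => Submodule.subset_span (inl_mem_cocycleLattice.2 hv)
      rw [A₁.spans] at this
      exact fun v => this trivial
    have k₂ : Submodule.span ℝ (A₂.lattice : Set A₂.V) ≤ W.map (LinearMap.snd ℝ A₁.V A₂.V) :=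
      Submodule.span_le.2 fun w hw =>
        ⟨_, Submodule.subset_span (mk_mem_cocycleLattice ⟨w, hw⟩), rfl⟩
    rw [A₂.spans] at k₂
    rintro ⟨v, w⟩ -
    obtain ⟨⟨v', _⟩, hx, rfl⟩ := k₂ (show w ∈ ⊤ from trivial)
    simpa using W.add_mem hx (k₁ (v - v'))

/-- The extension of `A₂` by `A₁` with cocycle `h`; its maps are induced by `v ↦ (v, 0)` and
`(v, w) ↦ w`. -/
noncomputable def ofCocycle (h : A₂.lattice →ₗ[ℤ] A₁.V) : Extension A₂ A₁ where
  mid := cocycleTorus h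
  ι := Hom.ofLinearMap (A := A₁) (B := cocycleTorus h) (LinearMap.inl ℂ A₁.V A₂.V)
    fun _ hx => inl_mem_cocycleLattice.2 hx
  p := Hom.ofLinearMap (A := cocycleTorus h) (B := A₂) (LinearMap.snd ℂ A₁.V A₂.V)
    fun _ hx => snd_mem_of_mem_cocycleLattice hx
  injective x y hxy := by
    obtain ⟨v, rfl⟩ := Submodule.mkQ_surjective _ x
    obtain ⟨v', rfl⟩ := Submodule.mkQ_surjective _ y
    have h1 : (v, (0 : A₂.V)) - (v', 0) ∈ cocycleLattice h := (Submodule.Quotient.eq _).1 hxy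
    rw [Prod.mk_sub_mk, sub_zero, inl_mem_cocycleLattice] at h1
    exact proj_eq.2 h1
  surjective x := by
    obtain ⟨w, rfl⟩ := Submodule.mkQ_surjective _ x
    exact ⟨(cocycleTorus h).proj ((0, w) : A₁.V × A₂.V), rfl⟩
  exact x := by
    obtain ⟨⟨v, w⟩, rfl⟩ := (cocycleTorus h).lattice.mkQ_surjective x
    constructor
    · intro hx
      have hw : w ∈ A₂.lattice := (Submodule.Quotient.mk_eq_zero _).1 hx
      refine ⟨A₁.proj (v - h ⟨w, hw⟩), ?_⟩
      refine (Submodule.Quotient.eq (cocycleLattice h)).2 ?_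
      convert (cocycleLattice h).neg_mem (mk_mem_cocycleLattice ⟨w, hw⟩) using 1
      refine Prod.ext ?_ ?_
      · change v - h ⟨w, hw⟩ - v = -h ⟨w, hw⟩
        abel
      · exact zero_sub w
    · rintro ⟨a, ha⟩
      obtain ⟨u, rfl⟩ := Submodule.mkQ_surjective _ a
      rw [← ha]
      exact map_zero (A₂.proj)

theorem ofCocycle_hasCocycle (h : A₂.lattice →ₗ[ℤ] A₁.V) : (ofCocycle h).HasCocycle h :=
  ⟨⟨LinearMap.inl ℂ A₁.V A₂.V, LinearMap.snd ℂ A₁.V A₂.V, LinearMap.inr ℂ A₁.V A₂.V,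
    fun _ => rfl, fun _ => rfl, fun _ => rfl⟩, fun w => by
      change ((0 : A₁.V), (w : A₂.V)) + (h w, (0 : A₂.V)) ∈ cocycleLattice h
      rw [Prod.mk_add_mk, zero_add, add_zero]
      exact mk_mem_cocycleLattice w⟩

/-! ### The Baer sum in terms of cocycles -/

/-- The cocycle `(h(w), h'(w'))` of a product extension. -/
def prodCocycle (h : A₂.lattice →ₗ[ℤ] A₁.V) (h' : B₂.lattice →ₗ[ℤ] B₁.V) :
    (A₂.prod B₂).lattice →ₗ[ℤ] (A₁.prod B₁).V :=
  show (A₂.lattice.prod B₂.lattice : Submodule ℤ (A₂.V × B₂.V)) →ₗ[ℤ] A₁.V × B₁.V from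
  { toFun x := (h ⟨x.1.1, x.2.1⟩, h' ⟨x.1.2, x.2.2⟩)
    map_add' x y := Prod.ext (h.map_add ⟨x.1.1, x.2.1⟩ ⟨y.1.1, y.2.1⟩)
      (h'.map_add ⟨x.1.2, x.2.2⟩ ⟨y.1.2, y.2.2⟩)
    map_smul' c x := Prod.ext (h.map_smul c ⟨x.1.1, x.2.1⟩) (h'.map_smul c ⟨x.1.2, x.2.2⟩) }

theorem isLift_prodMap {f : Hom A₁ A₂} {g : Hom B₁ B₂} {F : A₁.V →ₗ[ℂ] A₂.V}
    {G : B₁.V →ₗ[ℂ] B₂.V} (hf : f.IsLift F) (hg : g.IsLift G) :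
    (Hom.prodMap f g).IsLift (A := A₁.prod B₁) (B := A₂.prod B₂) (F.prodMap G) := by
  intro x
  refine Hom.prod_ext ?_ ?_
  · rw [Hom.prodMap, Hom.fst_pair]
    exact hf x.1
  · rw [Hom.prodMap, Hom.snd_pair]
    exact hg x.2

theorem isLift_diag (A : ComplexTorus) :
    (Hom.diag A).IsLift (A := A) (B := A.prod A) (LinearMap.id.prod LinearMap.id) := by
  intro x
  refine Hom.prod_ext ?_ ?_
  · rw [Hom.diag, Hom.fst_pair]; rfl
  · rw [Hom.diag, Hom.snd_pair]; rfl

theorem isLift_sum (A : ComplexTorus) :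
    (Hom.sum A).IsLift (A := A.prod A) (B := A)
      (LinearMap.fst ℂ A.V A.V + LinearMap.snd ℂ A.V A.V) := fun _ => rfl

theorem HasCocycle.prod {e : Extension A₂ A₁} {e' : Extension B₂ B₁}
    {h : A₂.lattice →ₗ[ℤ] A₁.V} {h' : B₂.lattice →ₗ[ℤ] B₁.V} (he : e.HasCocycle h)
    (he' : e'.HasCocycle h') : (e.prod e').HasCocycle (prodCocycle h h') := by
  obtain ⟨s, hs⟩ := he
  obtain ⟨s', hs'⟩ := he'
  exact ⟨⟨s.I.prodMap s'.I, s.P.prodMap s'.P, s.S.prodMap s'.S,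
    isLift_prodMap s.isLift_I s'.isLift_I, isLift_prodMap s.isLift_P s'.isLift_P,
    fun w => Prod.ext (s.P_S w.1) (s'.P_S w.2)⟩,
    fun w => ⟨hs ⟨w.1.1, w.2.1⟩, hs' ⟨w.1.2, w.2.2⟩⟩⟩

/-- The Baer sum of extensions corresponds to the sum of cocycles. -/
theorem isBaerSum_iff {e e' e'' : Extension A₂ A₁} {h h' h'' : A₂.lattice →ₗ[ℤ] A₁.V}
    (he : e.HasCocycle h) (he' : e'.HasCocycle h') (he'' : e''.HasCocycle h'') :
    IsBaerSum e e' e'' ↔ h'' - (h + h') ∈ coboundaries A₂ A₁ := by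
  have pull : ∀ {s : Extension A₂ (A₁.prod A₁)} {k}, s.HasCocycle k →
      (IsPullback (Hom.diag A₂) (e.prod e') s ↔
        ∃ C : A₂.V →ₗ[ℂ] A₁.V × A₁.V, ∀ w : A₂.lattice,
          (k w).1 - h w + (C w).1 ∈ A₁.lattice ∧ (k w).2 - h' w + (C w).2 ∈ A₁.lattice) := fun hs =>
    exists_hom_iff hs (he.prod he') (Hom.isLift_id (A₁.prod A₁)) (isLift_diag A₂)
  have push : ∀ {s : Extension A₂ (A₁.prod A₁)} {k}, s.HasCocycle k →
      (IsPushout (Hom.sum A₁) s e'' ↔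
        ∃ C : A₂.V →ₗ[ℂ] A₁.V, ∀ w : A₂.lattice,
          (k w).1 + (k w).2 - h'' w + C w ∈ A₁.lattice) := fun hs =>
    exists_hom_iff hs he'' (isLift_sum A₁) (Hom.isLift_id A₂)
  constructor
  · rintro ⟨s, h₁, h₂⟩
    obtain ⟨k, hk⟩ := s.exists_hasCocycle
    obtain ⟨C, hC⟩ := (pull hk).1 h₁
    obtain ⟨C', hC'⟩ := (push hk).1 h₂
    refine ⟨(LinearMap.fst ℂ A₁.V A₁.V + LinearMap.snd ℂ A₁.V A₁.V) ∘ₗ C - C', fun w => ?_⟩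
    convert A₁.lattice.sub_mem (A₁.lattice.add_mem (hC w).1 (hC w).2) (hC' w) using 1
    simp only [LinearMap.sub_apply, LinearMap.add_apply, LinearMap.comp_apply,
      LinearMap.fst_apply, LinearMap.snd_apply]
    abel
  · intro H
    rw [← neg_mem_iff, neg_sub] at H
    obtain ⟨C, hC⟩ := H
    let k : A₂.lattice →ₗ[ℤ] (A₁.prod A₁).V := (h.prod h' : A₂.lattice →ₗ[ℤ] A₁.V × A₁.V)
    have hk := ofCocycle_hasCocycle k
    refine ⟨ofCocycle k, (pull hk).2 ⟨0, fun w => ?_⟩, (push hk).2 ⟨C, hC⟩⟩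
    change h w - h w + 0 ∈ _ ∧ h' w - h' w + 0 ∈ _
    rw [sub_self, sub_self, add_zero]
    exact ⟨zero_mem _, zero_mem _⟩

/-- Extension classes are classified by cocycles modulo coboundaries. -/
noncomputable def cocycleEquiv (A₂ A₁ : ComplexTorus) :
    (A₂.lattice →ₗ[ℤ] A₁.V) ⧸ coboundaries A₂ A₁ ≃ Ext A₂ A₁ :=
  Equiv.ofBijective
    (Quotient.lift (fun h => (ofCocycle h).cls) fun h h' hh =>
      (cls_eq_iff (ofCocycle_hasCocycle h) (ofCocycle_hasCocycle h')).2 <| by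
        rw [← neg_mem_iff, neg_sub, sub_eq_neg_add]
        exact QuotientAddGroup.leftRel_apply.1 hh) <| by
    constructor
    · rintro ⟨h⟩ ⟨h'⟩ hh
      refine QuotientAddGroup.eq.2 ?_
      rw [neg_add_eq_sub, ← neg_mem_iff, neg_sub]
      exact (cls_eq_iff (ofCocycle_hasCocycle h) (ofCocycle_hasCocycle h')).1 hh
    · rintro ⟨e⟩
      obtain ⟨h, he⟩ := e.exists_hasCocycle
      refine ⟨QuotientAddGroup.mk h, (cls_eq_iff (ofCocycle_hasCocycle h) he).2 ?_⟩
      rw [sub_self]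
      exact zero_mem _

theorem HasCocycle.cls_eq {e : Extension A₂ A₁} {h : A₂.lattice →ₗ[ℤ] A₁.V}
    (he : e.HasCocycle h) : e.cls = cocycleEquiv A₂ A₁ (QuotientAddGroup.mk h) :=
  (cls_eq_iff he (ofCocycle_hasCocycle h)).2 (by rw [sub_self]; exact zero_mem _)

theorem isBaerSum_cocycleEquiv_iff (x y z : (A₂.lattice →ₗ[ℤ] A₁.V) ⧸ coboundaries A₂ A₁) :
    Ext.IsBaerSum (cocycleEquiv A₂ A₁ x) (cocycleEquiv A₂ A₁ y) (cocycleEquiv A₂ A₁ z) ↔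
      z = x + y := by
  constructor
  · rintro ⟨e, e', e'', h₁, h₂, h₃, hs⟩
    obtain ⟨h, he⟩ := e.exists_hasCocycle
    obtain ⟨h', he'⟩ := e'.exists_hasCocycle
    obtain ⟨h'', he''⟩ := e''.exists_hasCocycle
    rw [he.cls_eq, Equiv.apply_eq_iff_eq] at h₁
    rw [he'.cls_eq, Equiv.apply_eq_iff_eq] at h₂
    rw [he''.cls_eq, Equiv.apply_eq_iff_eq] at h₃
    rw [← h₁, ← h₂, ← h₃, ← QuotientAddGroup.mk_add, eq_comm, QuotientAddGroup.eq, neg_add_eq_sub]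
    exact (isBaerSum_iff he he' he'').1 hs
  · rintro rfl
    obtain ⟨h, rfl⟩ := QuotientAddGroup.mk_surjective x
    obtain ⟨h', rfl⟩ := QuotientAddGroup.mk_surjective y
    refine ⟨ofCocycle h, ofCocycle h', ofCocycle (h + h'), rfl, rfl, rfl,
      (isBaerSum_iff (ofCocycle_hasCocycle h) (ofCocycle_hasCocycle h')
        (ofCocycle_hasCocycle _)).2 ?_⟩
    rw [sub_self]
    exact zero_mem _

end Extension

end ComplexTorus

namespace PolarizedRealTorus

open ComplexTorus Extension Matrix

/-! ### Cocycles of period matrices -/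

variable {g g₁ g₂ : ℕ} {T : PolarizedRealTorus g} {T₁ : PolarizedRealTorus g₁}
  {T₂ : PolarizedRealTorus g₂} {P : GL (Fin g) ℝ} {P₁ : GL (Fin g₁) ℝ} {P₂ : GL (Fin g₂) ℝ}

theorem IsPeriodMatrix.mem_lattice_iff (h : T.IsPeriodMatrix P) {w : Fin g → ℂ} :
    w ∈ T.toComplexTorus.lattice ↔
      ∃ y : Fin g ⊕ Fin g → ℤ, bigPeriodMatrix P *ᵥ (fun j => (y j : ℂ)) = w := by
  rw [h.lattice_eq]
  rfl

theorem bigPeriodMatrix_mulVec (y : Fin g ⊕ Fin g → ℂ) :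
    bigPeriodMatrix P *ᵥ y = y ∘ Sum.inl + imagMatrix P *ᵥ (y ∘ Sum.inr) := by
  rw [bigPeriodMatrix, fromCols_mulVec, one_mulVec]

/-- The vector `P⁻¹ Im w`, which for a period `w = n + iPm` is `m`. -/
noncomputable def imagCoord (P : GL (Fin g) ℝ) : (Fin g → ℂ) →+ (Fin g → ℂ) where
  toFun w := fun j => ((P⁻¹.1 *ᵥ fun k => (w k).im) j : ℝ)
  map_zero' := by
    ext j
    simp [mulVec, dotProduct]
  map_add' w w' := by
    ext j
    simp [mulVec, dotProduct, mul_add, Finset.sum_add_distrib]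

theorem imagCoord_bigPeriodMatrix_mulVec (y : Fin g ⊕ Fin g → ℤ) :
    imagCoord P (bigPeriodMatrix P *ᵥ fun j => (y j : ℂ)) = fun j => (y (Sum.inr j) : ℂ) := by
  have h : (fun k => ((bigPeriodMatrix P *ᵥ fun j => (y j : ℂ)) k).im) =
      P.1 *ᵥ fun j => (y (Sum.inr j) : ℝ) := by
    ext k
    rw [bigPeriodMatrix_mulVec]
    simp [imagMatrix, mulVec, dotProduct]
  ext j
  change (((P⁻¹.1 *ᵥ fun k => ((bigPeriodMatrix P *ᵥ fun j => (y j : ℂ)) k).im) j : ℝ) : ℂ) = _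
  rw [h, mulVec_mulVec]
  simp

/-- The cocycle `n + iP₂m ↦ αm` of the extension with period matrix `((I, iP₁), (0, α))`,
`(0, (I, iP₂))`. -/
noncomputable def matrixCocycle (T₁ : PolarizedRealTorus g₁) (T₂ : PolarizedRealTorus g₂)
    (P₂ : GL (Fin g₂) ℝ) : Matrix (Fin g₁) (Fin g₂) ℂ →+
      (T₂.toComplexTorus.lattice →ₗ[ℤ] T₁.toComplexTorus.V) where
  toFun α := (show (Fin g₂ → ℂ) →+ (Fin g₁ → ℂ) from
    α.mulVecLin.toAddMonoidHom.comp (imagCoord P₂)).toIntLinearMap ∘ₗ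
      T₂.toComplexTorus.lattice.subtype
  map_zero' := LinearMap.ext fun w => zero_mulVec (imagCoord P₂ w.1)
  map_add' α β := LinearMap.ext fun _ => add_mulVec α β _

theorem matrixCocycle_apply (α : Matrix (Fin g₁) (Fin g₂) ℂ) (y : Fin g₂ ⊕ Fin g₂ → ℤ)
    (hy : bigPeriodMatrix P₂ *ᵥ (fun j => (y j : ℂ)) ∈ T₂.toComplexTorus.lattice) :
    matrixCocycle T₁ T₂ P₂ α ⟨bigPeriodMatrix P₂ *ᵥ fun j => (y j : ℂ), hy⟩ =
      α *ᵥ fun j => (y (Sum.inr j) : ℂ) :=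
  congrArg (α *ᵥ ·) (imagCoord_bigPeriodMatrix_mulVec y)

theorem periodExtension_hasCocycle (h₁ : T₁.IsPeriodMatrix P₁) (h₂ : T₂.IsPeriodMatrix P₂)
    (α : Matrix (Fin g₁) (Fin g₂) ℂ) :
    (periodExtension h₁ h₂ (fromCols 0 α)).HasCocycle (matrixCocycle T₁ T₂ P₂ α) := by
  let S : (Fin g₂ → ℂ) →ₗ[ℂ] (Fin g₁ ⊕ Fin g₂ → ℂ) :=
    { toFun := fun w => Sum.elim 0 w
      map_add' := fun z w => by ext j; cases j <;> simp
      map_smul' := fun c z => by ext j; cases j <;> simp }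
  refine ⟨⟨(inclMap g₁ g₂).toLinearMap, (projMap g₁ g₂).toLinearMap, S, fun _ => rfl,
    fun _ => rfl, fun _ => rfl⟩, ?_⟩
  rintro ⟨w, hw⟩
  obtain ⟨y, rfl⟩ := h₂.mem_lattice_iff.1 hw
  refine (mem_extensionLattice (fromCols 0 α) _).2 ⟨0, y, ?_, ?_⟩
  · have h0 : (fun j => (((0 : Fin g₁ ⊕ Fin g₁ → ℤ) j : ℤ) : ℂ)) = 0 := by ext; simp
    rw [matrixCocycle_apply, h0, mulVec_zero, fromCols_mulVec, zero_mulVec]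
    exact congrArg ((0 : Fin g₁ → ℂ) + ·) (zero_add (α *ᵥ fun j => (y (Sum.inr j) : ℂ))).symm
  · exact add_zero _

/-- In terms of period matrices, a cocycle is a coboundary if up to periods of `T₁` it is the
restriction of a linear map `w ↦ -Aw`. -/
theorem mem_coboundaries_iff_exists_matrix (h₁ : T₁.IsPeriodMatrix P₁) (h₂ : T₂.IsPeriodMatrix P₂)
    {k : T₂.toComplexTorus.lattice →ₗ[ℤ] T₁.toComplexTorus.V}
    {B : (Fin g₂ ⊕ Fin g₂ → ℤ) → Fin g₁ → ℂ}
    (hB : ∀ y hy, k ⟨bigPeriodMatrix P₂ *ᵥ fun j => (y j : ℂ), hy⟩ = B y) :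
    k ∈ coboundaries T₂.toComplexTorus T₁.toComplexTorus ↔
      ∃ A : Matrix (Fin g₁) (Fin g₂) ℂ, ∀ y, ∃ x : Fin g₁ ⊕ Fin g₁ → ℤ,
        bigPeriodMatrix P₁ *ᵥ (fun j => (x j : ℂ)) =
          B y + A *ᵥ (bigPeriodMatrix P₂ *ᵥ fun j => (y j : ℂ)) := by
  constructor
  · rintro ⟨C, hC⟩
    let C' : (Fin g₂ → ℂ) →ₗ[ℂ] (Fin g₁ → ℂ) := C
    refine ⟨LinearMap.toMatrix' C', fun y => ?_⟩
    have h := hC ⟨_, h₂.mem_lattice_iff.2 ⟨y, rfl⟩⟩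
    rw [hB] at h
    rw [LinearMap.toMatrix'_mulVec]
    exact h₁.mem_lattice_iff.1 h
  · rintro ⟨A, hA⟩
    refine ⟨A.mulVecLin, ?_⟩
    rintro ⟨w, hw⟩
    obtain ⟨y, rfl⟩ := h₂.mem_lattice_iff.1 hw
    rw [hB]
    exact h₁.mem_lattice_iff.2 (hA y)

/-- The cocycle of `α` is a coboundary precisely if `α` lies in
`(I, iP₁) ℤ^(2g₁, 2g₂) (iP₂ ; I)`. -/
theorem matrixCocycle_mem_coboundaries_iff (h₁ : T₁.IsPeriodMatrix P₁)
    (h₂ : T₂.IsPeriodMatrix P₂) (α : Matrix (Fin g₁) (Fin g₂) ℂ) :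
    matrixCocycle T₁ T₂ P₂ α ∈ coboundaries T₂.toComplexTorus T₁.toComplexTorus ↔
      α ∈ periodSubgroup P₁ P₂ := by
  rw [mem_coboundaries_iff_exists_matrix h₁ h₂ (matrixCocycle_apply α)]
  constructor
  · rintro ⟨A, hA⟩
    let J : Matrix (Fin g₂) (Fin g₂ ⊕ Fin g₂) ℂ := fromCols 0 1
    choose m hm using fun j => hA (Pi.single j 1)
    let M : Matrix (Fin g₁ ⊕ Fin g₁) (Fin g₂ ⊕ Fin g₂) ℤ := of fun i j => m j i
    have hM : bigPeriodMatrix P₁ * M.map (fun n : ℤ => (n : ℂ)) =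
        α * J + A * bigPeriodMatrix P₂ := by
      ext i j
      have hcast : (fun k => ((Pi.single j 1 : Fin g₂ ⊕ Fin g₂ → ℤ) k : ℂ)) = Pi.single j 1 := by
        ext k
        by_cases hk : k = j
        · subst hk; simp
        · simp [hk]
      have hJ : (fun k => ((Pi.single j 1 : Fin g₂ ⊕ Fin g₂ → ℤ) (Sum.inr k) : ℂ)) =
          J *ᵥ Pi.single j 1 := by
        rw [← hcast, fromCols_mulVec, zero_mulVec, zero_add, one_mulVec]
        rfl
      have h := hm j
      rw [hJ, hcast, mulVec_mulVec, mulVec_mulVec, ← add_mulVec, mulVec_single_one] at h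
      exact congrFun h i
    -- Right multiplication by `(-iP₂ ; I)` annihilates `(I, iP₂)`.
    have hα : bigPeriodMatrix P₁ * M.map (fun n : ℤ => (n : ℂ)) *
        fromRows (-imagMatrix P₂) (1 : Matrix (Fin g₂) (Fin g₂) ℂ) = α := by
      rw [hM, Matrix.add_mul, Matrix.mul_assoc, Matrix.mul_assoc, bigPeriodMatrix,
        fromCols_mul_fromRows, fromCols_mul_fromRows]
      simp
    refine ⟨fromCols (-M.toCols₁) M.toCols₂, ?_⟩
    rw [← hα]
    change _ * _ * _ = _
    rw [Matrix.mul_assoc, Matrix.mul_assoc]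
    congr 1
    have e₁ : (fromCols (-M.toCols₁) M.toCols₂).map (fun n : ℤ => (n : ℂ)) =
        fromCols (-(M.toCols₁.map fun n : ℤ => (n : ℂ))) (M.toCols₂.map fun n : ℤ => (n : ℂ)) := by
      ext i (j | j) <;> simp
    have e₂ : M.map (fun n : ℤ => (n : ℂ)) =
        fromCols (M.toCols₁.map fun n : ℤ => (n : ℂ)) (M.toCols₂.map fun n : ℤ => (n : ℂ)) := by
      ext i (j | j) <;> simp
    rw [e₁, e₂, fromCols_mul_fromRows, fromCols_mul_fromRows, Matrix.neg_mul, Matrix.mul_neg]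
  · rintro ⟨M, rfl⟩
    let N₁ := M.toCols₁.map fun n : ℤ => (n : ℂ)
    let N₂ := M.toCols₂.map fun n : ℤ => (n : ℂ)
    have e : M.map (fun n : ℤ => (n : ℂ)) = fromCols N₁ N₂ := by
      ext i (j | j) <;> simp [N₁, N₂]
    -- The term `(I, iP₁) M₁ iP₂` of `α` is removed by the linear map `-(I, iP₁) M₁`.
    refine ⟨-(bigPeriodMatrix P₁ * N₁), fun y =>
      ⟨M.toCols₂ *ᵥ (y ∘ Sum.inr) - M.toCols₁ *ᵥ (y ∘ Sum.inl), ?_⟩⟩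
    have e' : (fun i => ((M.toCols₂ *ᵥ (y ∘ Sum.inr) - M.toCols₁ *ᵥ (y ∘ Sum.inl)) i : ℂ)) =
        N₂ *ᵥ (fun j => (y (Sum.inr j) : ℂ)) - N₁ *ᵥ (fun j => (y (Sum.inl j) : ℂ)) := by
      ext i
      simp [N₁, N₂, mulVec, dotProduct]
    rw [e']
    simp only [e, Matrix.mul_assoc, fromCols_mul_fromRows, bigPeriodMatrix_mulVec (P := P₂),
      Matrix.mul_one, ← mulVec_mulVec, add_mulVec, mulVec_add, mulVec_sub, neg_mulVec,
      Function.comp_def]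
    abel

/-- Every cocycle is cohomologous to one that vanishes on `ℤ^g₂`, which is the cocycle of a
matrix: subtract the complex linear map which agrees with it on the standard basis. -/
theorem exists_matrixCocycle_sub_mem_coboundaries (h₁ : T₁.IsPeriodMatrix P₁)
    (h₂ : T₂.IsPeriodMatrix P₂) (h : T₂.toComplexTorus.lattice →ₗ[ℤ] T₁.toComplexTorus.V) :
    ∃ α, h - matrixCocycle T₁ T₂ P₂ α ∈ coboundaries T₂.toComplexTorus T₁.toComplexTorus := by
  let h' : T₂.toComplexTorus.lattice →ₗ[ℤ] (Fin g₁ → ℂ) := h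
  let π : (Fin g₂ ⊕ Fin g₂ → ℤ) →+ T₂.toComplexTorus.lattice :=
    { toFun y := ⟨bigPeriodMatrix P₂ *ᵥ fun j => (y j : ℂ), h₂.mem_lattice_iff.2 ⟨y, rfl⟩⟩
      map_zero' := Subtype.ext <| by
        change bigPeriodMatrix P₂ *ᵥ _ = 0
        ext
        simp [mulVec, dotProduct]
      map_add' x y := Subtype.ext <| by
        change bigPeriodMatrix P₂ *ᵥ _ = bigPeriodMatrix P₂ *ᵥ _ + bigPeriodMatrix P₂ *ᵥ _
        rw [← mulVec_add]
        congr 1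
        ext
        simp }
  let B : Matrix (Fin g₁) (Fin g₂ ⊕ Fin g₂) ℂ := of fun i j => h' (π (Pi.single j 1)) i
  have hB : ∀ y : Fin g₂ ⊕ Fin g₂ → ℤ, h' (π y) =
      B.toCols₁ *ᵥ (fun j => (y (Sum.inl j) : ℂ)) +
        B.toCols₂ *ᵥ fun j => (y (Sum.inr j) : ℂ) := by
    intro y
    have hy : y = ∑ j, y j • Pi.single j (1 : ℤ) := by
      ext k
      simp [Finset.sum_apply, Pi.single_apply]
    have hs : h' (π y) = ∑ j, y j • h' (π (Pi.single j 1)) := by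
      conv_lhs => rw [hy, map_sum, map_sum]
      exact Finset.sum_congr rfl fun j _ => by rw [map_zsmul, map_zsmul]
    rw [hs]
    ext i
    simp [Finset.sum_apply, mulVec, dotProduct, B, mul_comm]
  refine ⟨B.toCols₂ - B.toCols₁ * imagMatrix P₂,
    (mem_coboundaries_iff_exists_matrix h₁ h₂
      (B := fun y => B.toCols₁ *ᵥ (bigPeriodMatrix P₂ *ᵥ fun j => (y j : ℂ))) fun y hy => ?_).2
      ⟨-B.toCols₁, fun y => ⟨0, ?_⟩⟩⟩
  · rw [LinearMap.sub_apply, matrixCocycle_apply]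
    change h' (π y) - _ = _
    rw [hB, bigPeriodMatrix_mulVec, sub_mulVec, mulVec_add, mulVec_mulVec]
    simp only [Function.comp_def]
    abel
  · rw [neg_mulVec, add_neg_cancel]
    ext
    simp [mulVec, dotProduct]

end PolarizedRealTorus

/-! ### The classification -/

theorem proposition6p3 {g₁ g₂ : ℕ} (T₁ : PolarizedRealTorus g₁) (T₂ : PolarizedRealTorus g₂)
    (P₁ : GL (Fin g₁) ℝ) (P₂ : GL (Fin g₂) ℝ)
    (h₁ : T₁.IsPeriodMatrix P₁) (h₂ : T₂.IsPeriodMatrix P₂) :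
    ∃ _ : AddCommGroup (PolarizedRealTorus.ExtPt T₂ T₁),
      (∀ a b c : PolarizedRealTorus.ExtPt T₂ T₁,
        ComplexTorus.Ext.IsBaerSum a b c ↔ c = a + b) ∧
      ∃ Φ : (Matrix (Fin g₁) (Fin g₂) ℂ ⧸ periodSubgroup P₁ P₂) ≃+
          PolarizedRealTorus.ExtPt T₂ T₁,
        ∀ α : Matrix (Fin g₁) (Fin g₂) ℂ,
          Φ (QuotientAddGroup.mk α) =
            (PolarizedRealTorus.periodExtension h₁ h₂ (Matrix.fromCols 0 α)).cls := by
  let N := ComplexTorus.Extension.coboundaries T₂.toComplexTorus T₁.toComplexTorus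
  let E := ComplexTorus.Extension.cocycleEquiv T₂.toComplexTorus T₁.toComplexTorus
  -- The group structure on extension classes is transported along the classification by cocycles.
  let _ : AddCommGroup (PolarizedRealTorus.ExtPt T₂ T₁) := E.symm.addCommGroup
  let E' : _ ≃+ PolarizedRealTorus.ExtPt T₂ T₁ := (Equiv.addEquiv E.symm).symm
  let Θ := (QuotientAddGroup.mk' N).comp (PolarizedRealTorus.matrixCocycle T₁ T₂ P₂)
  have hker : periodSubgroup P₁ P₂ = Θ.ker := by
    ext α
    rw [← PolarizedRealTorus.matrixCocycle_mem_coboundaries_iff h₁ h₂, AddMonoidHom.mem_ker]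
    exact (QuotientAddGroup.eq_zero_iff _).symm
  have hsurj : Function.Surjective Θ := by
    intro x
    obtain ⟨h, rfl⟩ := QuotientAddGroup.mk_surjective x
    obtain ⟨α, hα⟩ :=
      PolarizedRealTorus.exists_matrixCocycle_sub_mem_coboundaries h₁ h₂ h
    exact ⟨α, QuotientAddGroup.eq.2 (by rwa [neg_add_eq_sub])⟩
  refine ⟨inferInstance, fun a b c => ?_,
    (QuotientAddGroup.quotientAddEquivOfEq hker).trans
      ((QuotientAddGroup.quotientKerEquivOfSurjective Θ hsurj).trans E'), fun α => ?_⟩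
  · obtain ⟨x, rfl⟩ := E.surjective a
    obtain ⟨y, rfl⟩ := E.surjective b
    obtain ⟨z, rfl⟩ := E.surjective c
    exact (ComplexTorus.Extension.isBaerSum_cocycleEquiv_iff x y z).trans
      (by rw [← E.apply_eq_iff_eq]; exact Eq.congr_right (map_add E' x y))
  · exact ((PolarizedRealTorus.periodExtension_hasCocycle h₁ h₂ α).cls_eq).symm
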